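/- **Setting.** Let $\mathfrak o$ be a Dedekind domain which is not a field, $K$ its field of fractions, $L/K$ a (possibly infinite) Galois extension with group $G=\mathrm{Gal}(L/K)$ equipped with the Krull topology, and let $\mathfrak O$ be the integral closure of $\mathfrak o$ in $L$. Let $\mathrm{m\text{-}Spec}\,R$ denote the set of maximal ideals of a ring $R$. A fractional ideal of $\mathfrak O$ is a non-zero $\mathfrak O$-submodule $I\subseteq L$ with $dI\subseteq\mathfrak O$ for some $d\in L^\times$; let $\mathcal F(\mathfrak O)$ be the monoid of fractional ideals under multiplication. It carries the left $G$-action $\sigma(I)=\{\sigma(x): x\in I\}$. Call $I\in\mathcal F(\mathfrak O)$ regular if $I=IJI$ for some $J\in\mathcal F(\mathfrak O)$, and invertible if $IJ=\mathfrak O$ for some $J\in\mathcal F(\mathfrak O)$. Let $\widetilde{\mathbb R}=\mathbb R\times\{0,1\}$ with the lexicographic order, the addition $(\alpha,s)+(\beta,t)=(\alpha+\beta,\max\{s,t\})$ and the involution $\iota(\alpha,s)=(-\alpha,s)$. For a topological space $X$ and a submonoid $M\subseteq\widetilde{\mathbb R}$, let $\mathcal S^u_{0,b}(X;M)$ be the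 monoid (under pointwise addition) of all functions $f\colon X\to M$ that are upper semicontinuous (i.e. $\{x: f(x)<a\}$ is open for every $a\in\widetilde{\mathbb R}$), bounded above and below, and equal to $(0,0)$ outside some compact subset of $X$. If $\iota(M)=M$, let $\mathcal S^u_{0,\mathrm{ref}}(X;M)$ be the submonoid of those $f$ with $f,\ \iota\circ f\in\mathcal S^u_{0,b}(X;M)$. For $\mathfrak P\in\mathrm{m\text{-}Spec}\,\mathfrak O$, let $v_{\mathfrak P}\colon L^\times\to\mathbb Q$ be the additive valuation at $\mathfrak P$ normalized by $v_{\mathfrak P}(K^\times)=\mathbb Z$: for every finite subextension $M/K$ of $L/K$, its restriction to $M^\times$ is the order at the prime $\mathfrak P\cap M$ of the integral closure of $\mathfrak o$ in $M$, divided by the ramification index of $\mathfrak P\cap M$ over $\mathfrak P\cap\mathfrak o$. Put $\mathrm{val}_{\mathfrak P}=\{(\alpha,0):\alpha\in v_{\mathfrak P}(L^\times)\}$, and let $V_{\mathfrak P}$ be the closure of $v_{\mathfrak P}(L^\times)$ in $\mathbb R$. Let $\widetilde V_{\mathfrak P}=\mathrm{val}_{\mathfrak P}\sqcup\{(\beta,1):\beta\in\mathbb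 R\}$ if $V_{\mathfrak P}=\mathbb R$, and $\widetilde V_{\mathfrak P}=\mathrm{val}_{\mathfrak P}$ otherwise. For $I\in\mathcal F(\mathfrak O)$ let $\tilde f_I\colon\mathrm{m\text{-}Spec}\,\mathfrak O\to\widetilde{\mathbb R}$ be the function with $\tilde f_I(\mathfrak P)=(\alpha,s)$, where $\alpha=\inf\{v_{\mathfrak P}(x): x\in I\setminus\{0\}\}$, and $s=0$ if this infimum is attained, $s=1$ if not. For each $\mathfrak p\in\mathrm{m\text{-}Spec}\,\mathfrak o$ fix a maximal ideal $\mathfrak p_L$ of $\mathfrak O$ above $\mathfrak p$, let $D_{\mathfrak p}=\{\sigma\in G:\sigma(\mathfrak p_L)=\mathfrak p_L\}$, give $G/D_{\mathfrak p}$ the quotient topology, and write $\widetilde V_{\mathfrak p}=\widetilde V_{\mathfrak p_L}$, $\mathrm{val}_{\mathfrak p}=\mathrm{val}_{\mathfrak p_L}$. The group $G$ acts on functions on $G/D_{\mathfrak p}$ by $(\sigma g)(x)=g(\sigma^{-1}x)$. **Corollary 2.10.** (i) The assignment $I\mapsto\big(\sigma D_{\mathfrak p}\mapsto\tilde f_I(\sigma(\mathfrak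 p_L))\big)_{\mathfrak p}$ is a well-defined $G$-equivariant isomorphism of monoids $$(\widetilde F_{\mathfrak p})_{\mathfrak p}\colon\ \mathcal F(\mathfrak O)\ \xrightarrow{\ \simeq\ }\ \bigoplus_{\mathfrak p\in\mathrm{m\text{-}Spec}\,\mathfrak o}\mathcal S^u_{0,b}(G/D_{\mathfrak p};\widetilde V_{\mathfrak p}).$$ (ii) The image of the set of regular elements of $\mathcal F(\mathfrak O)$ is $\bigoplus_{\mathfrak p}\mathcal S^u_{0,\mathrm{ref}}(G/D_{\mathfrak p};\widetilde V_{\mathfrak p})$. (iii) The image of the set of invertible ideals is $\bigoplus_{\mathfrak p}\mathcal S^u_{0,\mathrm{ref}}(G/D_{\mathfrak p};\mathrm{val}_{\mathfrak p})$. -/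

import Mathlib

open scoped nonZeroDivisors Pointwise DirectSum

namespace KrullIdeals

/-! ### The totally ordered monoid `ℝ × {0, 1}` -/

/-- The set `ℝ × {0, 1}`; the flag `false` stands for `0` and `true` for `1`. -/
@[ext]
structure RTilde where
  /-- the real component -/
  re : ℝ
  /-- the component in `{0, 1}` -/
  flag : Bool

namespace RTilde

/-- The lexicographic order. -/
noncomputable instance : LinearOrder RTilde :=
  LinearOrder.lift' (fun a : RTilde => toLex (a.re, a.flag)) (by
    intro a b h
    have h' := toLex.injective h
    exact RTilde.ext (congrArg Prod.fst h') (congrArg Prod.snd h'))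

theorem lt_iff (a b : RTilde) :
    a < b ↔ a.re < b.re ∨ (a.re = b.re ∧ a.flag < b.flag) :=
  Prod.Lex.toLex_lt_toLex (x := (a.re, a.flag)) (y := (b.re, b.flag))

/-- `(α, s) + (β, t) = (α + β, max s t)`. -/
noncomputable instance : Add RTilde := ⟨fun a b => ⟨a.re + b.re, max a.flag b.flag⟩⟩

/-- The neutral element is `(0, 0)`. -/
noncomputable instance : Zero RTilde := ⟨⟨0, false⟩⟩

@[simp] theorem add_re (a b : RTilde) : (a + b).re = a.re + b.re := rfl
@[simp] theorem add_flag (a b : RTilde) : (a + b).flag = max a.flag b.flag := rfl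
@[simp] theorem zero_re : (0 : RTilde).re = 0 := rfl
@[simp] theorem zero_flag : (0 : RTilde).flag = false := rfl

noncomputable instance : AddCommMonoid RTilde where
  add_assoc a b c := RTilde.ext (add_assoc _ _ _) (max_assoc _ _ _)
  zero_add a := RTilde.ext (zero_add _) (by simp)
  add_zero a := RTilde.ext (add_zero _) (by simp)
  add_comm a b := RTilde.ext (add_comm _ _) (max_comm _ _)
  nsmul := nsmulRec

/-- The involution `ι (α, s) = (-α, s)`. -/
noncomputable def iota (a : RTilde) : RTilde := ⟨-a.re, a.flag⟩

theorem iota_add (a b : RTilde) : iota (a + b) = iota a + iota b :=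
  RTilde.ext (by simp [iota]; ring) rfl

theorem iota_zero : iota 0 = 0 := RTilde.ext (by simp [iota]) rfl

instance : IsOrderedAddMonoid RTilde where
  add_le_add_left a b h c := by
    rcases h.lt_or_eq with h | h
    · rw [lt_iff] at h
      rcases h with h | ⟨h, hs⟩
      · exact ((lt_iff _ _).2 (Or.inl (by simpa using h))).le
      · rcases (max_le_max hs.le (le_refl c.flag)).lt_or_eq with h1 | h1
        · exact ((lt_iff _ _).2 (Or.inr ⟨by simp [h], h1⟩)).le
        · exact (RTilde.ext (by simp [h]) h1 : a + c = b + c).le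
    · rw [h]

end RTilde

/-! ### Semicontinuous functions -/

section Functions

variable {X : Type*} [TopologicalSpace X]

/-- Upper semicontinuity of a function with values in `ℝ × {0, 1}`. -/
def IsUSC (f : X → RTilde) : Prop := ∀ a : RTilde, IsOpen {x | f x < a}

/-- Boundedness, above and below. -/
def IsBdd (f : X → RTilde) : Prop := ∃ a b : RTilde, ∀ x, a ≤ f x ∧ f x ≤ b

/-- The function is `(0, 0)` outside some compact subset. -/
def IsCptSupported (f : X → RTilde) : Prop := ∃ Y : Set X, IsCompact Y ∧ ∀ x, x ∉ Y → f x = 0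

theorem IsUSC.add {f g : X → RTilde} (hf : IsUSC f) (hg : IsUSC g) : IsUSC (f + g) := by
  intro a
  rw [isOpen_iff_forall_mem_open]
  intro x hx
  have hx' : f x + g x < a := hx
  rw [RTilde.lt_iff] at hx'
  rcases hx' with h | ⟨h, hs⟩
  · simp only [RTilde.add_re] at h
    set ε := (a.re - (f x).re - (g x).re) / 2 with hε
    have hε0 : 0 < ε := by rw [hε]; linarith
    refine ⟨{y | f y < ⟨(f x).re + ε, false⟩} ∩ {y | g y < ⟨(g x).re + ε, false⟩}, ?_,
      (hf _).inter (hg _), ?_⟩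
    · rintro y ⟨hy1, hy2⟩
      have hy1 := (RTilde.lt_iff _ _).1 hy1
      have hy2 := (RTilde.lt_iff _ _).1 hy2
      replace hy1 : (f y).re ≤ (f x).re + ε := hy1.elim le_of_lt (fun h => h.1.le)
      replace hy2 : (g y).re < (g x).re + ε := hy2.elim id (fun h => absurd h.2 (by simp))
      refine (RTilde.lt_iff _ _).2 (Or.inl ?_)
      change (f y).re + (g y).re < a.re
      linarith
    · constructor
      · exact (RTilde.lt_iff _ _).2 (Or.inl (by simpa using hε0))
      · exact (RTilde.lt_iff _ _).2 (Or.inl (by simpa using hε0))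
  · simp only [RTilde.add_re, RTilde.add_flag] at h hs
    have ha : a.flag = true := by
      cases ha : a.flag
      · rw [ha] at hs; exact absurd hs (by simp)
      · rfl
    rw [ha] at hs
    have hfg : (f x).flag = false ∧ (g x).flag = false := by
      cases h1 : (f x).flag <;> cases h2 : (g x).flag <;> simp [h1, h2] at hs ⊢
    refine ⟨{y | f y < ⟨(f x).re, true⟩} ∩ {y | g y < ⟨(g x).re, true⟩}, ?_,
      (hf _).inter (hg _), ?_⟩
    · rintro y ⟨hy1, hy2⟩
      have hy1 := (RTilde.lt_iff _ _).1 hy1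
      have hy2 := (RTilde.lt_iff _ _).1 hy2
      refine (RTilde.lt_iff _ _).2 ?_
      change (f y).re + (g y).re < a.re ∨
        ((f y).re + (g y).re = a.re ∧ max (f y).flag (g y).flag < a.flag)
      rw [ha, ← h]
      rcases hy1 with hy1 | ⟨hy1, hs1⟩
      · left
        rcases hy2 with hy2 | ⟨hy2, hs2⟩ <;> simp at hy1 hy2 <;> linarith
      · rcases hy2 with hy2 | ⟨hy2, hs2⟩
        · left; simp at hy1 hy2; linarith
        · right
          simp at hy1 hy2
          exact ⟨by rw [hy1, hy2], max_lt hs1 hs2⟩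
    · exact ⟨(RTilde.lt_iff _ _).2 (Or.inr ⟨rfl, by simp [hfg.1]⟩),
        (RTilde.lt_iff _ _).2 (Or.inr ⟨rfl, by simp [hfg.2]⟩)⟩

theorem isUSC_zero : IsUSC (0 : X → RTilde) := by
  intro a
  by_cases h : (0 : RTilde) < a
  · simp [h]
  · simp [h]

theorem IsBdd.add {X : Type*} {f g : X → RTilde} (hf : IsBdd f) (hg : IsBdd g) : IsBdd (f + g) := by
  obtain ⟨a, b, h⟩ := hf
  obtain ⟨c, d, h'⟩ := hg
  exact ⟨a + c, b + d, fun x => ⟨add_le_add (h x).1 (h' x).1, add_le_add (h x).2 (h' x).2⟩⟩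

theorem IsCptSupported.add {f g : X → RTilde} (hf : IsCptSupported f) (hg : IsCptSupported g) :
    IsCptSupported (f + g) := by
  obtain ⟨Y, hY, h⟩ := hf
  obtain ⟨Z, hZ, h'⟩ := hg
  refine ⟨Y ∪ Z, hY.union hZ, fun x hx => ?_⟩
  rw [Set.mem_union, not_or] at hx
  simp [h x hx.1, h' x hx.2]

variable (X) in
/-- The monoid of all bounded, compactly supported, upper semicontinuous functions on `X` with
values in the submonoid `M` of `ℝ × {0, 1}`, under pointwise addition. -/
def S0b (M : AddSubmonoid RTilde) : AddSubmonoid (X → RTilde) where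
  carrier := {f | (∀ x, f x ∈ M) ∧ IsUSC f ∧ IsBdd f ∧ IsCptSupported f}
  zero_mem' := ⟨fun _ => M.zero_mem, isUSC_zero, ⟨0, 0, fun _ => ⟨le_rfl, le_rfl⟩⟩,
    ⟨∅, isCompact_empty, fun _ _ => rfl⟩⟩
  add_mem' := fun hf hg => ⟨fun x => M.add_mem (hf.1 x) (hg.1 x), hf.2.1.add hg.2.1,
    hf.2.2.1.add hg.2.2.1, hf.2.2.2.add hg.2.2.2⟩

variable (X) in
/-- The reflexible functions: those `f` such that both `f` and `ι ∘ f` lie in `S0b X M`. -/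
def Sref (M : AddSubmonoid RTilde) : AddSubmonoid (X → RTilde) where
  carrier := {f | f ∈ S0b X M ∧ RTilde.iota ∘ f ∈ S0b X M}
  zero_mem' := ⟨zero_mem _, by
    have : RTilde.iota ∘ (0 : X → RTilde) = 0 := funext fun _ => RTilde.iota_zero
    rw [this]; exact zero_mem _⟩
  add_mem' := fun {f g} hf hg => ⟨add_mem hf.1 hg.1, by
    have : RTilde.iota ∘ (f + g) = RTilde.iota ∘ f + RTilde.iota ∘ g :=
      funext fun _ => RTilde.iota_add _ _
    rw [this]; exact add_mem hf.2 hg.2⟩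

end Functions

/-! ### The normalized valuations

`o` is a Dedekind domain with fraction field `K`, `L` is an algebraic (separable) extension of
`K`, and `integralClosure o L` is the ring of interest. -/

section Valuation

variable {o K L : Type*} [CommRing o] [IsDedekindDomain o] [Field K] [Algebra o K]
  [IsFractionRing o K] [Field L] [Algebra K L] [Algebra o L] [IsScalarTower o K L]
  [Algebra.IsSeparable K L]

instance (M : IntermediateField K L) [FiniteDimensional K M] :
    IsDedekindDomain (integralClosure o M) :=
  integralClosure.isDedekindDomain o K M

instance (M : IntermediateField K L) [FiniteDimensional K M] :
    IsFractionRing (integralClosure o M) M :=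
  integralClosure.isFractionRing_of_finite_extension K M

/-- The inclusion of the integral closure of `o` in `M` into the integral closure of `o` in `L`. -/
def inclM (o : Type*) {K L : Type*} [CommRing o] [Field K] [Algebra o K] [Field L] [Algebra K L]
    [Algebra o L] [IsScalarTower o K L] (M : IntermediateField K L) :
    integralClosure o M →ₐ[o] integralClosure o L :=
  (M.val.restrictScalars o).mapIntegralClosure

/-- The maximal ideal `P ∩ o` of `o`. -/
noncomputable def below (ho : ¬ IsField o) (P : MaximalSpectrum (integralClosure o L)) :
    IsDedekindDomain.HeightOneSpectrum o where
  asIdeal := P.asIdeal.comap (algebraMap o (integralClosure o L))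
  isPrime := P.isMaximal.isPrime.comap _
  ne_bot := by
    have := P.isMaximal
    exact Ring.ne_bot_of_isMaximal_of_not_isField
      (Ideal.isMaximal_comap_of_isIntegral_of_isMaximal P.asIdeal) ho

/-- The nonzero prime `P ∩ M` of the integral closure of `o` in a finite subextension `M`. -/
noncomputable def belowM (ho : ¬ IsField o) (P : MaximalSpectrum (integralClosure o L))
    (M : IntermediateField K L) [FiniteDimensional K M] :
    IsDedekindDomain.HeightOneSpectrum (integralClosure o M) where
  asIdeal := P.asIdeal.comap (inclM o M)
  isPrime := P.isMaximal.isPrime.comap _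
  ne_bot := by
    intro h
    apply (below ho P).ne_bot
    rw [eq_bot_iff]
    intro a ha
    have h1 : algebraMap o (integralClosure o M) a ∈ P.asIdeal.comap (inclM o M) := by
      rw [Ideal.mem_comap, AlgHom.commutes]
      exact ha
    rw [h, Ideal.mem_bot] at h1
    have h2 : algebraMap o M a = 0 := congrArg Subtype.val h1
    rw [IsScalarTower.algebraMap_apply o K M, map_eq_zero] at h2
    exact (IsFractionRing.injective o K) (by rw [h2, map_zero])

/-- The order of vanishing of `x` at a nonzero prime `w` of a Dedekind domain. -/
noncomputable def ord {B F : Type*} [CommRing B] [IsDedekindDomain B] [Field F] [Algebra B F]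
    [IsFractionRing B F] (w : IsDedekindDomain.HeightOneSpectrum B) (x : F) : ℤ :=
  -WithZero.log (w.valuation F x)

/-- The additive valuation of `M` at `P ∩ M`, normalized so that the values on `K` are the
integers: the order at `P ∩ M` divided by the ramification index over `P ∩ o`. -/
noncomputable def valM (ho : ¬ IsField o) (P : MaximalSpectrum (integralClosure o L))
    (M : IntermediateField K L) [FiniteDimensional K M] (x : M) : ℚ :=
  (ord (belowM ho P M) x : ℚ) /
    ((below ho P).asIdeal.ramificationIdx' (belowM ho P M).asIdeal : ℚ)

theorem ord_mul {B F : Type*} [CommRing B] [IsDedekindDomain B] [Field F] [Algebra B F]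
    [IsFractionRing B F] (w : IsDedekindDomain.HeightOneSpectrum B) {x y : F}
    (hx : x ≠ 0) (hy : y ≠ 0) : ord w (x * y) = ord w x + ord w y := by
  unfold ord
  rw [map_mul, WithZero.log_mul (by simpa using hx) (by simpa using hy)]
  ring

theorem ord_liesOver {A B F E : Type*} [CommRing A] [IsDedekindDomain A] [CommRing B]
    [IsDedekindDomain B] [Algebra A B] [Module.IsTorsionFree A B] [Field F] [Field E] [Algebra F E]
    [Algebra A F] [IsFractionRing A F] [Algebra A E] [IsScalarTower A F E] [Algebra B E]
    [IsFractionRing B E] [IsScalarTower A B E] (v : IsDedekindDomain.HeightOneSpectrum A)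
    (w : IsDedekindDomain.HeightOneSpectrum B) (h : v.asIdeal = w.asIdeal.comap (algebraMap A B))
    (x : F) :
    ord w (algebraMap F E x) = (v.asIdeal.ramificationIdx' w.asIdeal : ℤ) * ord v x := by
  have : w.asIdeal.LiesOver v.asIdeal := ⟨h⟩
  unfold ord
  rw [← IsDedekindDomain.HeightOneSpectrum.valuation_liesOver E v w x, WithZero.log_pow]
  simp

theorem exists_ord_eq_mul {A B F E : Type*} [CommRing A] [IsDedekindDomain A] [CommRing B]
    [IsDedekindDomain B] [Field F] [Field E] [Algebra A F] [IsFractionRing A F] [Algebra B E]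
    [IsFractionRing B E] (v : IsDedekindDomain.HeightOneSpectrum A)
    (w : IsDedekindDomain.HeightOneSpectrum B) (φ : A →+* B) (ψ : F →+* E)
    (hc : ∀ a, ψ (algebraMap A F a) = algebraMap B E (φ a)) (h : v.asIdeal = w.asIdeal.comap φ) :
    ∃ n : ℕ, ∀ x : F, ord w (ψ x) = (n : ℤ) * ord v x := by
  let : Algebra A B := φ.toAlgebra
  let : Algebra F E := ψ.toAlgebra
  let : Algebra A E := (ψ.comp (algebraMap A F)).toAlgebra
  have : IsScalarTower A F E := IsScalarTower.of_algebraMap_eq fun _ => rfl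
  have : IsScalarTower A B E := IsScalarTower.of_algebraMap_eq hc
  have : FaithfulSMul A B := by
    rw [faithfulSMul_iff_algebraMap_injective]
    intro a b hab
    have h1 : φ a = φ b := hab
    apply IsFractionRing.injective A F
    apply ψ.injective
    rw [hc, hc, h1]
  exact ⟨_, ord_liesOver v w h⟩

instance (M : IntermediateField K L) [FiniteDimensional K M] :
    Module.IsTorsionFree o (integralClosure o M) := by
  have : FaithfulSMul o M := by
    rw [faithfulSMul_iff_algebraMap_injective, IsScalarTower.algebraMap_eq o K M]
    exact (algebraMap K M).injective.comp (IsFractionRing.injective o K)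
  have : FaithfulSMul o (integralClosure o M) := by
    rw [faithfulSMul_iff_algebraMap_injective]
    intro a b h
    exact FaithfulSMul.algebraMap_injective o M (congrArg Subtype.val h)
  infer_instance

theorem ord_belowM_algebraMap (ho : ¬ IsField o) (P : MaximalSpectrum (integralClosure o L))
    (M : IntermediateField K L) [FiniteDimensional K M] (c : K) :
    ord (belowM ho P M) (algebraMap K M c) =
      ((below ho P).asIdeal.ramificationIdx' (belowM ho P M).asIdeal : ℤ) * ord (below ho P) c := by
  refine ord_liesOver _ _ ?_ c
  change _ = (P.asIdeal.comap (inclM o M)).comap _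
  ext a
  rw [Ideal.mem_comap, Ideal.mem_comap, AlgHom.commutes]
  rfl

theorem ramificationIdx_ne_zero (ho : ¬ IsField o) (P : MaximalSpectrum (integralClosure o L))
    (M : IntermediateField K L) [FiniteDimensional K M] :
    (below ho P).asIdeal.ramificationIdx' (belowM ho P M).asIdeal ≠ 0 := by
  have : (belowM ho P M).asIdeal.LiesOver (below ho P).asIdeal := ⟨by
    ext a
    change _ ↔ inclM o M _ ∈ P.asIdeal
    rw [AlgHom.commutes]
    rfl⟩
  exact Ideal.IsDedekindDomain.ramificationIdx'_ne_zero_of_liesOver _ (below ho P).ne_bot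

theorem exists_ord_eq_one (v : IsDedekindDomain.HeightOneSpectrum o) : ∃ c : K, ord v c = 1 := by
  obtain ⟨c, hc⟩ := v.valuation_exists_uniformizer K
  exact ⟨c, by simp [ord, hc]⟩

/-- On `K` the valuation is the order at `P ∩ o`; in particular its values there are all the
integers. -/
theorem valM_algebraMap (ho : ¬ IsField o) (P : MaximalSpectrum (integralClosure o L))
    (M : IntermediateField K L) [FiniteDimensional K M] (c : K) :
    valM ho P M (algebraMap K M c) = (ord (below ho P) c : ℚ) := by
  have h := ramificationIdx_ne_zero ho P M
  unfold valM
  rw [ord_belowM_algebraMap]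
  push_cast
  field_simp

/-- The valuations on the finite subextensions are compatible. -/
theorem valM_inclusion (ho : ¬ IsField o) (P : MaximalSpectrum (integralClosure o L))
    {M N : IntermediateField K L} [FiniteDimensional K M] [FiniteDimensional K N] (h : M ≤ N)
    (x : M) : valM ho P N (IntermediateField.inclusion h x) = valM ho P M x := by
  obtain ⟨n, key⟩ := exists_ord_eq_mul (belowM ho P M) (belowM ho P N)
    ((IntermediateField.inclusion h).restrictScalars o).mapIntegralClosure.toRingHom
    (IntermediateField.inclusion h).toRingHom (fun _ => rfl) rfl
  replace key : ∀ y : M, ord (belowM ho P N) (IntermediateField.inclusion h y) =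
    (n : ℤ) * ord (belowM ho P M) y := key
  have hM := ramificationIdx_ne_zero ho P M
  have hN := ramificationIdx_ne_zero ho P N
  obtain ⟨c, hc⟩ := exists_ord_eq_one (K := K) (below ho P)
  have e1 := key (algebraMap K M c)
  rw [AlgHom.commutes, ord_belowM_algebraMap, ord_belowM_algebraMap, hc, mul_one, mul_one] at e1
  have e1' : ((below ho P).asIdeal.ramificationIdx' (belowM ho P N).asIdeal : ℚ) =
    (n : ℚ) *
      ((below ho P).asIdeal.ramificationIdx' (belowM ho P M).asIdeal : ℚ) := by exact_mod_cast e1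
  have hMN : (n : ℚ) ≠ 0 := by
    intro h0
    rw [h0, zero_mul] at e1'
    exact hN (by exact_mod_cast e1')
  have hM' : ((below ho P).asIdeal.ramificationIdx' (belowM ho P M).asIdeal : ℚ) ≠ 0 := by
    exact_mod_cast hM
  unfold valM
  rw [key, e1']
  push_cast
  field_simp

instance (x : L) : FiniteDimensional K (IntermediateField.adjoin K {x}) :=
  IntermediateField.adjoin.finiteDimensional (Algebra.IsIntegral.isIntegral x)

variable (K)

/-- The normalized additive valuation `L^× → ℚ` at `P`: on `x` it takes the value of the
normalized valuation of the finite subextension `K(x)`. -/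
noncomputable def val (ho : ¬ IsField o) (P : MaximalSpectrum (integralClosure o L)) (x : Lˣ) : ℚ :=
  valM ho P (IntermediateField.adjoin K {(x : L)}) (IntermediateField.AdjoinSimple.gen K (x : L))

/-- The valuation at `P` may be computed in any finite subextension containing the element. -/
theorem val_eq (ho : ¬ IsField o) (P : MaximalSpectrum (integralClosure o L)) (x : Lˣ)
    (M : IntermediateField K L) [FiniteDimensional K M] (hx : (x : L) ∈ M) :
    val K ho P x = valM ho P M ⟨x, hx⟩ := by
  have h : IntermediateField.adjoin K {(x : L)} ≤ M := by
    rw [IntermediateField.adjoin_le_iff]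
    simpa using hx
  exact (valM_inclusion ho P h (IntermediateField.AdjoinSimple.gen K (x : L))).symm

theorem val_mul (ho : ¬ IsField o) (P : MaximalSpectrum (integralClosure o L)) (x y : Lˣ) :
    val K ho P (x * y) = val K ho P x + val K ho P y := by
  let M := IntermediateField.adjoin K {(x : L)} ⊔ IntermediateField.adjoin K {(y : L)}
  have hx : (x : L) ∈ M :=
    (le_sup_left : _ ≤ M) (IntermediateField.mem_adjoin_simple_self K (x : L))
  have hy : (y : L) ∈ M :=
    (le_sup_right : _ ≤ M) (IntermediateField.mem_adjoin_simple_self K (y : L))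
  rw [val_eq K ho P x M hx, val_eq K ho P y M hy,
    val_eq K ho P (x * y) M (by rw [Units.val_mul]; exact mul_mem hx hy)]
  have hx0 : (⟨x, hx⟩ : M) ≠ 0 := fun h => x.ne_zero (congrArg Subtype.val h)
  have hy0 : (⟨y, hy⟩ : M) ≠ 0 := fun h => y.ne_zero (congrArg Subtype.val h)
  unfold valM
  rw [← add_div, ← Int.cast_add, ← ord_mul _ hx0 hy0]
  rfl

theorem val_one (ho : ¬ IsField o) (P : MaximalSpectrum (integralClosure o L)) :
    val K ho P 1 = 0 := by
  have := val_mul K ho P 1 1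
  rw [mul_one] at this
  linarith

/-- `{(α, 0) : α ∈ v_P(L^×)}`. -/
noncomputable def valMonoid (ho : ¬ IsField o) (P : MaximalSpectrum (integralClosure o L)) :
    AddSubmonoid RTilde where
  carrier := {a | (∃ x : Lˣ, a.re = (val K ho P x : ℝ)) ∧ a.flag = false}
  zero_mem' := ⟨⟨1, by simp [val_one]⟩, rfl⟩
  add_mem' := by
    rintro a b ⟨⟨x, hx⟩, ha⟩ ⟨⟨y, hy⟩, hb⟩
    exact ⟨⟨x * y, by rw [val_mul]; simp [hx, hy]⟩, by simp [ha, hb]⟩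

/-- `V_P`, the closure of `v_P(L^×)` in `ℝ`. -/
noncomputable def valClosure (ho : ¬ IsField o) (P : MaximalSpectrum (integralClosure o L)) :
    Set ℝ :=
  closure (Set.range fun x : Lˣ => (val K ho P x : ℝ))

/-- The monoid `Ṽ_P`: it is `valMonoid`, together with all `(β, 1)`, `β ∈ ℝ`, in case
`V_P = ℝ`. -/
noncomputable def VTilde (ho : ¬ IsField o) (P : MaximalSpectrum (integralClosure o L)) :
    AddSubmonoid RTilde where
  carrier := {a | a ∈ valMonoid K ho P ∨ (valClosure K ho P = Set.univ ∧ a.flag = true)}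
  zero_mem' := Or.inl (zero_mem _)
  add_mem' := by
    rintro a b (ha | ⟨h, ha⟩) (hb | ⟨h', hb⟩)
    · exact Or.inl (add_mem ha hb)
    · exact Or.inr ⟨h', by simp [hb]⟩
    · exact Or.inr ⟨h, by simp [ha]⟩
    · exact Or.inr ⟨h, by simp [ha]⟩

/-! ### Fractional ideals and the functions attached to them -/

section Ideals

variable (o L) in
/-- The monoid of all nonzero fractional ideals of the integral closure of `o` in `L`. -/
def FracIdeals : Submonoid (FractionalIdeal (integralClosure o L)⁰ L) where
  carrier := {I | I ≠ 0}
  one_mem' := by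
    intro h
    have h1 : (1 : L) ∈ (1 : FractionalIdeal (integralClosure o L)⁰ L) :=
      FractionalIdeal.one_mem_one _
    rw [h, FractionalIdeal.mem_zero_iff] at h1
    exact one_ne_zero h1
  mul_mem' := by
    intro I J hI hJ h
    obtain ⟨x, hx, hx0⟩ : ∃ x ∈ I, x ≠ 0 := by
      by_contra! hc
      exact hI (FractionalIdeal.eq_zero_iff.2 hc)
    obtain ⟨y, hy, hy0⟩ : ∃ y ∈ J, y ≠ 0 := by
      by_contra! hc
      exact hJ (FractionalIdeal.eq_zero_iff.2 hc)
    have hxy := FractionalIdeal.mul_mem_mul hx hy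
    rw [h, FractionalIdeal.mem_zero_iff] at hxy
    exact mul_ne_zero hx0 hy0 hxy

/-- The values of `v_P` on the nonzero elements of `I` (`v_P(0) = +∞` plays no role in the
infimum). -/
def valuesOn (ho : ¬ IsField o) (I : FracIdeals o L) (P : MaximalSpectrum (integralClosure o L)) :
    Set ℝ :=
  {r | ∃ x : Lˣ, (x : L) ∈ (I : FractionalIdeal (integralClosure o L)⁰ L) ∧ r = (val K ho P x : ℝ)}

open Classical in
/-- The function of a fractional ideal `I`: its value at `P` is `(α, 0)` or `(α, 1)`, where `α` is
the infimum of `v_P` on `I`, according to whether `α` is attained or not. -/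
noncomputable def fTilde (ho : ¬ IsField o) (I : FracIdeals o L)
    (P : MaximalSpectrum (integralClosure o L)) : RTilde where
  re := sInf (valuesOn K ho I P)
  flag := if sInf (valuesOn K ho I P) ∈ valuesOn K ho I P then false else true

end Ideals

end Valuation

/-! ### The Galois action -/

section Galois

variable {o K L : Type*} [CommRing o] [Field K] [Algebra o K] [Field L] [Algebra K L] [Algebra o L]
  [IsScalarTower o K L]

/-- The maximal ideal `σ(P)`. -/
def galSpec (σ : Gal(L/K)) (P : MaximalSpectrum (integralClosure o L)) :
    MaximalSpectrum (integralClosure o L) where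
  asIdeal := σ • P.asIdeal
  isMaximal := by
    have := P.isMaximal
    rw [Ideal.pointwise_smul_eq_comap]
    exact Ideal.comap_isMaximal_of_equiv _

variable (K) in
/-- The decomposition group of `P`. -/
def decomp (P : MaximalSpectrum (integralClosure o L)) : Subgroup Gal(L/K) :=
  MulAction.stabilizer Gal(L/K) P.asIdeal

/-- The fractional ideal `σ(I) = {σ(x) : x ∈ I}`. -/
def galIdeal (σ : Gal(L/K)) (I : FracIdeals o L) : FracIdeals o L :=
  ⟨⟨{ carrier := σ '' {x : L | x ∈ (I : FractionalIdeal (integralClosure o L)⁰ L)}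
      zero_mem' := ⟨0, FractionalIdeal.zero_mem _, map_zero σ⟩
      add_mem' := by
        rintro _ _ ⟨x, hx, rfl⟩ ⟨y, hy, rfl⟩
        exact ⟨x + y, Submodule.add_mem _ hx hy, map_add σ x y⟩
      smul_mem' := by
        rintro c _ ⟨x, hx, rfl⟩
        refine ⟨(σ⁻¹ • c) • x, Submodule.smul_mem _ _ hx, ?_⟩
        change σ (σ⁻¹ (c : L) * x) = (c : L) * σ x
        rw [map_mul, ← AlgEquiv.mul_apply, mul_inv_cancel, AlgEquiv.one_apply] },
    by
      obtain ⟨a, ha, h⟩ := (I : FractionalIdeal (integralClosure o L)⁰ L).isFractional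
      refine ⟨σ • a, ?_, ?_⟩
      · rw [mem_nonZeroDivisors_iff_ne_zero] at ha ⊢
        rwa [smul_ne_zero_iff_ne]
      · rintro _ ⟨x, hx, rfl⟩
        obtain ⟨y, hy⟩ := h x hx
        refine ⟨σ • y, ?_⟩
        have hy' : (y : L) = (a : L) * x := hy
        change σ (y : L) = σ (a : L) * σ x
        rw [hy', map_mul]⟩,
    by
      intro h
      apply I.2
      rw [FractionalIdeal.eq_zero_iff]
      intro x hx
      have h1 := FractionalIdeal.eq_zero_iff.1 h (σ x) ⟨x, hx, rfl⟩
      exact (map_eq_zero σ).1 h1⟩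

end Galois

/-- The left action of a group `G` on the functions on `G ⧸ D`: `(σ g)(x) = g (σ⁻¹ x)`. -/
def galFun {G : Type*} [Group G] [TopologicalSpace G] [IsTopologicalGroup G] (D : Subgroup G)
    (M : AddSubmonoid RTilde) (σ : G) : S0b (G ⧸ D) M →+ S0b (G ⧸ D) M where
  toFun g := ⟨fun x => (g : G ⧸ D → RTilde) (σ⁻¹ • x), fun _ => g.2.1 _,
    fun a => (g.2.2.1 a).preimage (continuous_const_smul σ⁻¹),
    (let ⟨a, b, h⟩ := g.2.2.2.1; ⟨a, b, fun _ => h _⟩),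
    (let ⟨Y, hY, h⟩ := g.2.2.2.2
     ⟨σ • Y, hY.smul σ, fun _ hx => h _ fun hx' => hx (Set.mem_smul_set_iff_inv_smul_mem.2 hx')⟩)⟩
  map_zero' := rfl
  map_add' _ _ := rfl

end KrullIdeals

/-! The order on `RTilde` makes `fTilde K ho I P` the greatest lower bound of the values (v_P(u),
0), u in I nonzero, the flag recording whether it is attained (`isGLB_fTilde`). Additivity in I then
follows from the ultrametric inequality (`fTilde_mul`), and membership of the value in `VTilde` from
the alternative that a subgroup of ℝ is dense or cyclic. Since a fractional ideal is determined by
its localizations, u lies in I exactly when (v_P(u), 0) ≥ `fTilde K ho I P` for all P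
(`mem_iff_forall_fTilde_le`); this gives injectivity.

The image is described by `IsAdmissible`. Upper semicontinuity holds because some u in I has small
value at P, and this value is unchanged at σ(P) for all σ fixing K(u). Conversely, an admissible F
cuts out an ideal, and F must be recovered from it. Given z with F(P₀) ≤ (v_{P₀}(z), 0),
semicontinuity keeps this inequality on all primes that agree with P₀ on a large enough finite M.
Multiplying z by an element of M of value 0 at those primes and of large value at all others puts it
into the ideal without changing its value at P₀ (`exists_mem_ideal`).

Finally, the Galois group is transitive on the primes above each p, so a function on the maximal
spectrum amounts to a family of functions on the quotients G/D_p. A bound by an element of o amounts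
to boundedness of each member and finite support of the family. Regularity and invertibility become
pointwise identities in `RTilde`: f + ι∘f + f = f always, while f + ι∘f = 0 needs flag 0. -/

namespace KrullIdeals

/-! ### Orders at a prime of a Dedekind domain -/

section Ord

variable {B F : Type*} [CommRing B] [IsDedekindDomain B] [Field F] [Algebra B F]
  [IsFractionRing B F] (w : IsDedekindDomain.HeightOneSpectrum B)

theorem ord_nonneg_iff {x : F} (hx : x ≠ 0) : 0 ≤ ord w x ↔ w.valuation F x ≤ 1 := by
  have h : w.valuation F x ≠ 0 := by simpa using hx
  rw [ord, neg_nonneg, ← WithZero.log_one, WithZero.log_le_log h one_ne_zero]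

theorem ord_algebraMap_nonneg {r : B} (hr : algebraMap B F r ≠ 0) :
    0 ≤ ord w (algebraMap B F r) :=
  (ord_nonneg_iff w hr).2 (w.valuation_le_one r)

theorem ord_algebraMap_eq_zero {r : B} (hr : r ∉ w.asIdeal) : ord w (algebraMap B F r) = 0 := by
  rw [ord, (w.valuation_eq_one_iff_notMem (K := F)).2 hr, WithZero.log_one, neg_zero]

theorem one_le_ord_algebraMap {r : B} (hr : r ∈ w.asIdeal) (h0 : algebraMap B F r ≠ 0) :
    1 ≤ ord w (algebraMap B F r) := by
  have h : w.valuation F (algebraMap B F r) ≠ 0 := by simpa using h0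
  have h1 := (w.valuation_lt_one_iff_mem (K := F) r).2 hr
  rw [← WithZero.log_lt_log h one_ne_zero, WithZero.log_one] at h1
  unfold ord
  omega

theorem min_ord_le_ord_add {x y : F} (hx : x ≠ 0) (hy : y ≠ 0) (hxy : x + y ≠ 0) :
    min (ord w x) (ord w y) ≤ ord w (x + y) := by
  have hx' : w.valuation F x ≠ 0 := by simpa using hx
  have hy' : w.valuation F y ≠ 0 := by simpa using hy
  have h' : w.valuation F (x + y) ≠ 0 := by rwa [ne_eq, map_eq_zero]
  have h := (w.valuation F).map_add x y
  unfold ord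
  rcases le_max_iff.1 h with h | h
  · rw [← WithZero.log_le_log h' hx'] at h
    exact min_le_iff.2 (Or.inl (by omega))
  · rw [← WithZero.log_le_log h' hy'] at h
    exact min_le_iff.2 (Or.inr (by omega))

/-- A nonzero `b` may be cleared away from a prime `w₀` by an element outside `w₀`. -/
theorem exists_notMem_and_dvd_mul {b : B} (hb : b ≠ 0) :
    ∃ u ∉ w.asIdeal, ∀ w' : IsDedekindDomain.HeightOneSpectrum B, w' ≠ w →
      ∃ t ∉ w'.asIdeal, b ∣ t * u := by
  have hfin : FiniteMultiplicity w.asIdeal (Ideal.span {b}) :=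
    FiniteMultiplicity.of_prime_left w.prime (by simpa using hb)
  -- Split off the full power of w: (b) = wⁿJ with J not inside w. Take u in J outside w; for w' ≠
  -- w, an element t of w outside w' gives tⁿu ∈ wⁿJ = (b).
  obtain ⟨J, hJ, hwJ⟩ := hfin.exists_eq_pow_mul_and_not_dvd
  obtain ⟨u, huJ, huw⟩ : ∃ u ∈ J, u ∉ w.asIdeal := by
    by_contra! hc
    exact hwJ (Ideal.dvd_iff_le.2 hc)
  refine ⟨u, huw, fun w' hw' => ?_⟩
  have hle : ¬ w.asIdeal ≤ w'.asIdeal := by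
    intro hle
    exact hw' (IsDedekindDomain.HeightOneSpectrum.ext
      ((w.isMaximal.eq_of_le w'.isPrime.ne_top hle).symm))
  obtain ⟨t, htw, ht⟩ := SetLike.not_le_iff_exists.1 hle
  set n := multiplicity w.asIdeal (Ideal.span {b})
  refine ⟨t ^ n, fun h => ht (w'.isPrime.mem_of_pow_mem _ h), ?_⟩
  rw [← Ideal.mem_span_singleton, hJ]
  exact Ideal.mul_mem_mul (Ideal.pow_mem_pow htw _) huJ

end Ord

/-! ### Integrality in subextensions, and elements of the base ring -/

section Base

variable {o K L : Type*} [CommRing o] [Field K] [Algebra o K] [Field L] [Algebra K L]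
  [Algebra o L] [IsScalarTower o K L]

theorem isIntegral_coe_iff (M : IntermediateField K L) (x : M) :
    IsIntegral o (x : L) ↔ IsIntegral o x :=
  isIntegral_algHom_iff (M.val.restrictScalars o) M.val.injective

variable [IsDomain o] [IsFractionRing o K]

variable (K) in
/-- A nonzero element of the base ring, as a unit of `L`. -/
noncomputable def baseUnit (L : Type*) [Field L] [Algebra K L] [Algebra o L] [IsScalarTower o K L] :
    o⁰ →* Lˣ where
  toFun c := Units.mk0 (algebraMap o L c) (by
    rw [IsScalarTower.algebraMap_apply o K L]
    exact (map_ne_zero _).2 (IsFractionRing.to_map_ne_zero_of_mem_nonZeroDivisors c.2))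
  map_one' := Units.ext (by simp)
  map_mul' _ _ := Units.ext (by simp)

@[simp] theorem coe_baseUnit (c : o⁰) : (baseUnit K L c : L) = algebraMap o L c := rfl

end Base

/-! ### Elementary properties of the normalized valuations -/

section Valuation

variable {o K L : Type*} [CommRing o] [IsDedekindDomain o] [Field K] [Algebra o K]
  [IsFractionRing o K] [Field L] [Algebra K L] [Algebra o L] [IsScalarTower o K L]
  [Algebra.IsSeparable K L]

section Finite

variable (M : IntermediateField K L) [FiniteDimensional K M]

theorem valM_nonneg_of_ord (ho : ¬ IsField o) (P : MaximalSpectrum (integralClosure o L)) {x : M}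
    (h : 0 ≤ ord (belowM ho P M) x) : 0 ≤ valM ho P M x :=
  div_nonneg (by exact_mod_cast h) (Nat.cast_nonneg _)

theorem ord_nonneg_of_valM (ho : ¬ IsField o) (P : MaximalSpectrum (integralClosure o L)) {x : M}
    (h : 0 ≤ valM ho P M x) : 0 ≤ ord (belowM ho P M) x := by
  have hM := ramificationIdx_ne_zero ho P M
  have hM' : (0 : ℚ) < (below ho P).asIdeal.ramificationIdx' (belowM ho P M).asIdeal := by
    exact_mod_cast Nat.pos_of_ne_zero hM
  unfold valM at h
  rw [le_div_iff₀ hM', zero_mul] at h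
  exact_mod_cast h

end Finite

variable (K)
variable (ho : ¬ IsField o) (P : MaximalSpectrum (integralClosure o L))

theorem val_nonneg_of_isIntegral {u : Lˣ} (hu : IsIntegral o (u : L)) : 0 ≤ val K ho P u := by
  let M := IntermediateField.adjoin K {(u : L)}
  have hM : (u : L) ∈ M := IntermediateField.mem_adjoin_simple_self K (u : L)
  rw [val_eq K ho P u M hM]
  refine valM_nonneg_of_ord M ho P ?_
  let r : integralClosure o M := ⟨⟨u, hM⟩, (isIntegral_coe_iff M ⟨u, hM⟩).1 hu⟩
  refine ord_algebraMap_nonneg (belowM ho P M) (r := r) (fun h => u.ne_zero ?_)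
  exact congrArg Subtype.val h

theorem val_eq_zero_of_notMem {u : Lˣ} (a : integralClosure o L) (ha : (a : L) = u)
    (haP : a ∉ P.asIdeal) : val K ho P u = 0 := by
  let M := IntermediateField.adjoin K {(u : L)}
  have hM : (u : L) ∈ M := IntermediateField.mem_adjoin_simple_self K (u : L)
  rw [val_eq K ho P u M hM]
  let r : integralClosure o M := ⟨⟨u, hM⟩, (isIntegral_coe_iff M ⟨u, hM⟩).1 (by
    change IsIntegral o (u : L)
    rw [← ha]
    exact a.2)⟩
  have hr : inclM o M r = a := Subtype.ext ha.symm
  have h := ord_algebraMap_eq_zero (F := M) (belowM ho P M) (r := r) (by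
    change ¬ inclM o M r ∈ P.asIdeal
    rwa [hr])
  unfold valM
  change ((ord (belowM ho P M) (algebraMap (integralClosure o M) M r) : ℤ) : ℚ) / _ = 0
  rw [h]
  simp

/-- An element with nonnegative value at `P` lies in the localization at `P`. -/
theorem exists_notMem_isIntegral_mul {u : Lˣ} (hu : 0 ≤ val K ho P u) :
    ∃ s : integralClosure o L, s ∉ P.asIdeal ∧ IsIntegral o ((s : L) * u) := by
  let M := IntermediateField.adjoin K {(u : L)}
  have hM : (u : L) ∈ M := IntermediateField.mem_adjoin_simple_self K (u : L)
  rw [val_eq K ho P u M hM] at hu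
  have hu0 : (⟨u, hM⟩ : M) ≠ 0 := fun h => u.ne_zero (congrArg Subtype.val h)
  have h := (ord_nonneg_iff _ hu0).1 (ord_nonneg_of_valM M ho P hu)
  obtain ⟨n, d, hd⟩ :=
    IsDedekindDomain.HeightOneSpectrum.exists_primeCompl_mul_eq_of_integer _ _ h
  refine ⟨inclM o M d, d.2, ?_⟩
  have hd' : (u : L) * (d : M) = (n : M) := congrArg Subtype.val hd
  change IsIntegral o (((d : M) : L) * u)
  rw [mul_comm, hd']
  exact (isIntegral_coe_iff M _).2 n.2

theorem min_val_le_val_add {x y z : Lˣ} (h : (z : L) = x + y) :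
    min (val K ho P x) (val K ho P y) ≤ val K ho P z := by
  let M := IntermediateField.adjoin K {(x : L)} ⊔ IntermediateField.adjoin K {(y : L)}
  have hx : (x : L) ∈ M :=
    (le_sup_left : _ ≤ M) (IntermediateField.mem_adjoin_simple_self K (x : L))
  have hy : (y : L) ∈ M :=
    (le_sup_right : _ ≤ M) (IntermediateField.mem_adjoin_simple_self K (y : L))
  have hz : (z : L) ∈ M := h ▸ add_mem hx hy
  rw [val_eq K ho P x M hx, val_eq K ho P y M hy, val_eq K ho P z M hz]
  have hx0 : (⟨x, hx⟩ : M) ≠ 0 := fun h => x.ne_zero (congrArg Subtype.val h)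
  have hy0 : (⟨y, hy⟩ : M) ≠ 0 := fun h => y.ne_zero (congrArg Subtype.val h)
  have hz0 : (⟨z, hz⟩ : M) ≠ 0 := fun h => z.ne_zero (congrArg Subtype.val h)
  have hz' : (⟨z, hz⟩ : M) = ⟨x, hx⟩ + ⟨y, hy⟩ := Subtype.ext h
  rw [hz'] at hz0 ⊢
  have key := min_ord_le_ord_add (belowM ho P M) hx0 hy0 hz0
  unfold valM
  rw [min_div_div_right (α := ℚ) (Nat.cast_nonneg _)]
  refine div_le_div_of_nonneg_right ?_ (Nat.cast_nonneg _)
  exact_mod_cast key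

theorem val_inv (u : Lˣ) : val K ho P u⁻¹ = -val K ho P u := by
  have h := val_mul K ho P u⁻¹ u
  rw [inv_mul_cancel, val_one] at h
  linarith

theorem val_pow (u : Lˣ) (n : ℕ) : val K ho P (u ^ n) = n * val K ho P u := by
  induction n with
  | zero => simp [val_one]
  | succ n ih => rw [pow_succ, val_mul, ih]; push_cast; ring

theorem val_algebraMap {u : Lˣ} (c : K) (h : (u : L) = algebraMap K L c) :
    val K ho P u = (ord (below ho P) c : ℚ) := by
  let M := IntermediateField.adjoin K {(u : L)}
  have hM : (u : L) ∈ M := IntermediateField.mem_adjoin_simple_self K (u : L)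
  rw [val_eq K ho P u M hM, ← valM_algebraMap ho P M c]
  congr 1
  exact Subtype.ext h

theorem val_baseUnit_nonneg (c : o⁰) : 0 ≤ val K ho P (baseUnit K L c) :=
  val_nonneg_of_isIntegral K ho P isIntegral_algebraMap

theorem val_baseUnit_mul (c d : o⁰) : val K ho P (baseUnit K L (c * d)) =
    val K ho P (baseUnit K L c) + val K ho P (baseUnit K L d) := by
  rw [map_mul, val_mul]

theorem one_le_val_baseUnit {c : o⁰} (hc : (c : o) ∈ (below ho P).asIdeal) :
    1 ≤ val K ho P (baseUnit K L c) := by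
  rw [val_algebraMap K ho P (algebraMap o K c)
    (by rw [coe_baseUnit, IsScalarTower.algebraMap_apply o K L])]
  have h := one_le_ord_algebraMap (F := K) (below ho P) hc
    (IsFractionRing.to_map_ne_zero_of_mem_nonZeroDivisors c.2)
  exact_mod_cast h

theorem val_baseUnit_eq_zero {c : o⁰} (hc : (c : o) ∉ (below ho P).asIdeal) :
    val K ho P (baseUnit K L c) = 0 := by
  rw [val_algebraMap K ho P (algebraMap o K c)
    (by rw [coe_baseUnit, IsScalarTower.algebraMap_apply o K L]), ord_algebraMap_eq_zero _ hc]
  simp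

/-- Every element of `L` becomes integral after multiplication with a nonzero element of `o`. -/
theorem exists_isIntegral_baseUnit_mul (x : L) :
    ∃ c : o⁰, IsIntegral o ((baseUnit K L c : L) * x) := by
  have hx : IsAlgebraic o x := by
    rw [IsFractionRing.isAlgebraic_iff o K L]
    exact Algebra.IsAlgebraic.isAlgebraic x
  obtain ⟨y, hy, h⟩ := hx.exists_integral_multiple
  exact ⟨⟨y, mem_nonZeroDivisors_of_ne_zero hy⟩, by rwa [coe_baseUnit, ← Algebra.smul_def]⟩

/-- The values of a given element are bounded by the values of an element of `o`. -/
theorem exists_abs_val_le (u : Lˣ) : ∃ c : o⁰, ∀ P : MaximalSpectrum (integralClosure o L),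
    |val K ho P u| ≤ val K ho P (baseUnit K L c) := by
  obtain ⟨c, hc⟩ := exists_isIntegral_baseUnit_mul (o := o) K (u : L)
  obtain ⟨d, hd⟩ := exists_isIntegral_baseUnit_mul (o := o) K ((u⁻¹ : Lˣ) : L)
  refine ⟨c * d, fun P => ?_⟩
  have h1 := val_nonneg_of_isIntegral K ho P (u := baseUnit K L c * u) hc
  have h2 := val_nonneg_of_isIntegral K ho P (u := baseUnit K L d * u⁻¹) hd
  have h3 := val_baseUnit_nonneg K ho P c
  have h4 := val_baseUnit_nonneg K ho P d
  rw [val_mul] at h1 h2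
  rw [val_inv] at h2
  rw [val_baseUnit_mul, abs_le]
  constructor <;> linarith

/-- The maximal ideal `P ∩ o` of `o`. -/
noncomputable def under (P : MaximalSpectrum (integralClosure o L)) : MaximalSpectrum o where
  asIdeal := P.asIdeal.comap (algebraMap o (integralClosure o L))
  isMaximal := by
    have := P.isMaximal
    exact Ideal.isMaximal_comap_of_isIntegral_of_isMaximal P.asIdeal

theorem finite_setOf_mem (c : o⁰) : {p : MaximalSpectrum o | (c : o) ∈ p.asIdeal}.Finite := by
  have h0 : Ideal.span {(c : o)} ≠ ⊥ := by
    simp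
  have h := Ideal.finite_factors h0
  -- Over a field there is only one maximal ideal; otherwise the maximal ideals containing c are
  -- height one primes dividing (c).
  by_cases ho : IsField o
  · have : Subsingleton (MaximalSpectrum o) := by
      refine ⟨fun p q => MaximalSpectrum.ext ?_⟩
      have := (Ring.isField_iff_maximal_bot).1 ho
      exact (this.eq_of_le p.isMaximal.ne_top bot_le).symm.trans
        (this.eq_of_le q.isMaximal.ne_top bot_le)
    exact Set.toFinite _
  · refine Set.Finite.of_finite_image (f := fun p : MaximalSpectrum o => p.asIdeal)
      ((h.image fun v => v.asIdeal).subset ?_)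
      (fun p _ q _ hpq => MaximalSpectrum.ext hpq)
    rintro _ ⟨p, hp, rfl⟩
    have hp' := p.isMaximal
    refine ⟨⟨p.asIdeal, p.isMaximal.isPrime,
      Ring.ne_bot_of_isMaximal_of_not_isField p.isMaximal ho⟩, ?_, rfl⟩
    exact Ideal.dvd_iff_le.2 ((Ideal.span_singleton_le_iff_mem _).2 hp)

/-- There are elements of `o` with large values above finitely many given primes. -/
theorem exists_le_val_baseUnit (T : Finset (MaximalSpectrum o)) (N : ℕ) :
    ∃ c : o⁰, ∀ P : MaximalSpectrum (integralClosure o L), under P ∈ T →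
      (N : ℚ) ≤ val K ho P (baseUnit K L c) := by
  classical
  induction T using Finset.induction_on with
  | empty => exact ⟨1, by simp⟩
  | insert p T _ ih =>
    obtain ⟨c, hc⟩ := ih
    obtain ⟨d, hd, hd0⟩ := Submodule.exists_mem_ne_zero_of_ne_bot
      (Ring.ne_bot_of_isMaximal_of_not_isField p.isMaximal ho)
    let d' : o⁰ := ⟨d, mem_nonZeroDivisors_of_ne_zero hd0⟩
    -- Here d is a nonzero element of p, so it has value at least 1 above p, and its N-th power has
    -- value at least N there; the factor c handles T.
    refine ⟨d' ^ N * c, fun P hP => ?_⟩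
    rw [val_baseUnit_mul, map_pow, val_pow]
    have h1 := val_baseUnit_nonneg K ho P c
    have h2 := val_baseUnit_nonneg K ho P d'
    rcases Finset.mem_insert.1 hP with h | h
    · have h3 : 1 ≤ val K ho P (baseUnit K L d') := one_le_val_baseUnit K ho P (by
        change d ∈ (under P).asIdeal
        rwa [h])
      nlinarith [(Nat.cast_nonneg N : (0 : ℚ) ≤ N)]
    · have := hc P h
      have : 0 ≤ (N : ℚ) * val K ho P (baseUnit K L d') := by positivity
      linarith

end Valuation

/-! ### The Galois action on maximal ideals and its transitivity -/

section Action

variable {o K L : Type*} [CommRing o] [Field K] [Algebra o K] [Field L] [Algebra K L] [Algebra o L]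
  [IsScalarTower o K L]

theorem galSpec_mul (σ τ : Gal(L/K)) (P : MaximalSpectrum (integralClosure o L)) :
    galSpec (σ * τ) P = galSpec σ (galSpec τ P) :=
  MaximalSpectrum.ext (mul_smul σ τ P.asIdeal)

theorem galSpec_one (P : MaximalSpectrum (integralClosure o L)) :
    galSpec (1 : Gal(L/K)) P = P :=
  MaximalSpectrum.ext (one_smul _ P.asIdeal)

theorem galSpec_inv_galSpec (σ : Gal(L/K)) (P : MaximalSpectrum (integralClosure o L)) :
    galSpec σ⁻¹ (galSpec σ P) = P := by
  rw [← galSpec_mul, inv_mul_cancel, galSpec_one]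

theorem galSpec_galSpec_inv (σ : Gal(L/K)) (P : MaximalSpectrum (integralClosure o L)) :
    galSpec σ (galSpec σ⁻¹ P) = P := by
  rw [← galSpec_mul, mul_inv_cancel, galSpec_one]

theorem galSpec_eq_galSpec_iff (σ τ : Gal(L/K)) (P : MaximalSpectrum (integralClosure o L)) :
    galSpec σ P = galSpec τ P ↔
      (QuotientGroup.mk σ : Gal(L/K) ⧸ decomp K P) = QuotientGroup.mk τ := by
  rw [QuotientGroup.eq, decomp, MulAction.mem_stabilizer_iff, mul_smul, inv_smul_eq_iff]
  exact ⟨fun h => congrArg MaximalSpectrum.asIdeal h.symm, fun h => MaximalSpectrum.ext h.symm⟩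

theorem smul_mem_galSpec_iff (σ : Gal(L/K)) (P : MaximalSpectrum (integralClosure o L))
    (a : integralClosure o L) : σ • a ∈ (galSpec σ P).asIdeal ↔ a ∈ P.asIdeal :=
  Ideal.smul_mem_pointwise_smul_iff

theorem under_galSpec [IsDomain o] (σ : Gal(L/K)) (P : MaximalSpectrum (integralClosure o L)) :
    under (galSpec σ P) = under P := by
  refine MaximalSpectrum.ext (Ideal.ext fun a => ?_)
  change algebraMap o (integralClosure o L) a ∈ (galSpec σ P).asIdeal ↔
    algebraMap o (integralClosure o L) a ∈ P.asIdeal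
  rw [← smul_mem_galSpec_iff σ P, smul_algebraMap]

/-- A closed group of automorphisms acts transitively on the maximal ideals over a given one of
its ring of invariants. -/
theorem exists_galSpec_eq [IsGalois K L] {A : Type*} [CommRing A]
    (φ : A →+* integralClosure o L) (H : Subgroup Gal(L/K)) (hH : IsClosed (H : Set Gal(L/K)))
    (hφ : ∀ σ ∈ H, ∀ a, σ • φ a = φ a) (hinv : ∀ b, (∀ σ ∈ H, σ • b = b) → ∃ a, φ a = b)
    {P Q : MaximalSpectrum (integralClosure o L)} (h : P.asIdeal.comap φ = Q.asIdeal.comap φ) :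
    ∃ σ ∈ H, Q = galSpec σ P := by
  let : Algebra A (integralClosure o L) := φ.toAlgebra
  -- With the discrete topology the action is continuous, because stabilizers of single elements are
  -- open in the Krull topology; H is compact as a closed subgroup. The profinite transitivity
  -- theorem then applies.
  let : TopologicalSpace (integralClosure o L) := ⊥
  have : DiscreteTopology (integralClosure o L) := ⟨rfl⟩
  have : CompactSpace H := isCompact_iff_compactSpace.1 hH.isCompact
  have : SMulCommClass H A (integralClosure o L) := ⟨fun σ a b => by
    change (σ : Gal(L/K)) • (φ a * b) = φ a * ((σ : Gal(L/K)) • b)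
    rw [smul_mul', hφ _ σ.2]⟩
  have : Algebra.IsInvariant A (integralClosure o L) H :=
    ⟨fun b hb => hinv b fun σ hσ => hb ⟨σ, hσ⟩⟩
  have : ContinuousSMul H (integralClosure o L) := by
    rw [continuousSMul_iff_stabilizer_isOpen]
    intro b
    have h1 := (stabilizer_isOpen_of_isIntegral (K := K) (b : L)).preimage
      (continuous_subtype_val (p := fun σ => σ ∈ H))
    convert h1 using 1
    ext σ
    exact ⟨fun hσ => congrArg Subtype.val hσ, fun hσ => Subtype.ext hσ⟩
  have := P.isMaximal
  have := Q.isMaximal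
  obtain ⟨σ, hσ⟩ := Algebra.IsInvariant.exists_smul_of_under_eq_of_profinite
    (A := A) (G := H) P.asIdeal Q.asIdeal h
  exact ⟨σ, σ.2, MaximalSpectrum.ext hσ⟩

/-- By the infinite Galois correspondence, the integral elements fixed by Gal(L/M) are precisely
those lying in M. -/
theorem exists_galSpec_eq_of_comap_inclM [IsGalois K L] (M : IntermediateField K L)
    {P Q : MaximalSpectrum (integralClosure o L)}
    (h : P.asIdeal.comap (inclM o M) = Q.asIdeal.comap (inclM o M)) :
    ∃ σ ∈ M.fixingSubgroup, Q = galSpec σ P := by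
  refine exists_galSpec_eq (inclM o M).toRingHom M.fixingSubgroup
    (InfiniteGalois.fixingSubgroup_isClosed M)
    (fun σ hσ a => Subtype.ext ?_) (fun b hb => ?_) h
  · exact (IntermediateField.mem_fixingSubgroup_iff M σ).1 hσ _ (a : M).2
  · have hbM : (b : L) ∈ M := by
      rw [← InfiniteGalois.fixedField_fixingSubgroup M]
      exact fun σ => congrArg Subtype.val (hb σ σ.2)
    exact ⟨⟨⟨b, hbM⟩, (isIntegral_coe_iff M ⟨b, hbM⟩).1 b.2⟩, rfl⟩

/-- The same argument for the full group: invariants lie in K and are integral over o, hence lie in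
o, which is integrally closed. -/
theorem exists_galSpec_eq_of_under [IsGalois K L] [IsDomain o] [IsIntegrallyClosed o]
    [IsFractionRing o K] {P Q : MaximalSpectrum (integralClosure o L)} (h : under P = under Q) :
    ∃ σ : Gal(L/K), Q = galSpec σ P := by
  have hinv : ∀ b : integralClosure o L, (∀ σ ∈ (⊤ : Subgroup Gal(L/K)), σ • b = b) →
      ∃ a, algebraMap o (integralClosure o L) a = b := by
    intro b hb
    obtain ⟨c, hc⟩ := (InfiniteGalois.mem_range_algebraMap_iff_fixed (k := K) (b : L)).2
      fun σ => congrArg Subtype.val (hb σ trivial)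
    have hb' : IsIntegral o (algebraMap K L c) := hc ▸ b.2
    rw [isIntegral_algebraMap_iff (algebraMap K L).injective] at hb'
    obtain ⟨a, rfl⟩ := IsIntegrallyClosed.algebraMap_eq_of_integral hb'
    refine ⟨a, Subtype.ext ?_⟩
    rw [← hc, ← IsScalarTower.algebraMap_apply]
    rfl
  obtain ⟨σ, -, hσ⟩ := exists_galSpec_eq (algebraMap o (integralClosure o L)) ⊤ isClosed_univ
    (fun σ _ a => smul_algebraMap σ a) hinv (congrArg MaximalSpectrum.asIdeal h)
  exact ⟨σ, hσ⟩

/-- The action of the Galois group on the units of `L`. -/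
def galUnit (σ : Gal(L/K)) : Lˣ →* Lˣ := Units.map (σ : L →* L)

@[simp] theorem coe_galUnit (σ : Gal(L/K)) (u : Lˣ) : (galUnit σ u : L) = σ u := rfl

theorem below_galSpec [IsDedekindDomain o] (ho : ¬ IsField o) (σ : Gal(L/K))
    (P : MaximalSpectrum (integralClosure o L)) :
    below ho (galSpec σ P) = below ho P :=
  IsDedekindDomain.HeightOneSpectrum.ext (congrArg MaximalSpectrum.asIdeal (under_galSpec σ P))

end Action

/-! ### Galois invariance of the valuations and value monoids -/

section Valuation

variable {o K L : Type*} [CommRing o] [IsDedekindDomain o] [Field K] [Algebra o K]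
  [IsFractionRing o K] [Field L] [Algebra K L] [Algebra o L] [IsScalarTower o K L]
  [Algebra.IsSeparable K L]

/-- σ carries P ∩ M to σ(P) ∩ σ(M), so the two orders differ by a constant factor n. Since σ fixes
K, evaluating on a uniformizer of P ∩ o shows that the ramification indices differ by the same
factor, which cancels. -/
theorem val_galSpec (ho : ¬ IsField o) (σ : Gal(L/K)) (P : MaximalSpectrum (integralClosure o L))
    {u v : Lˣ} (h : (v : L) = σ u) : val K ho (galSpec σ P) v = val K ho P u := by
  let M := IntermediateField.adjoin K {(u : L)}
  have hM : (u : L) ∈ M := IntermediateField.mem_adjoin_simple_self K (u : L)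
  let N := M.map (σ : L →ₐ[K] L)
  let ψ : M →ₐ[K] N := (M.equivMap (σ : L →ₐ[K] L)).toAlgHom
  have : FiniteDimensional K N := Module.Finite.equiv (M.equivMap (σ : L →ₐ[K] L)).toLinearEquiv
  have hψ : ∀ x : M, ((ψ x : N) : L) = σ x := fun x => rfl
  have hN : (v : L) ∈ N := ⟨u, hM, h.symm⟩
  rw [val_eq K ho P u M hM, val_eq K ho _ v N hN]
  have hv : (⟨v, hN⟩ : N) = ψ ⟨u, hM⟩ := Subtype.ext h
  rw [hv]
  obtain ⟨n, key⟩ := exists_ord_eq_mul (belowM ho P M) (belowM ho (galSpec σ P) N)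
    (ψ.restrictScalars o).mapIntegralClosure.toRingHom ψ.toRingHom (fun _ => rfl) (by
      ext a
      change inclM o M a ∈ P.asIdeal ↔
        inclM o N ((ψ.restrictScalars o).mapIntegralClosure a) ∈ (galSpec σ P).asIdeal
      rw [← smul_mem_galSpec_iff σ]
      rfl)
  replace key : ∀ y : M, ord (belowM ho (galSpec σ P) N) (ψ y) =
    (n : ℤ) * ord (belowM ho P M) y := key
  have hM := ramificationIdx_ne_zero ho P M
  have hN := ramificationIdx_ne_zero ho (galSpec σ P) N
  obtain ⟨c, hc⟩ := exists_ord_eq_one (K := K) (below ho P)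
  have e1 := key (algebraMap K M c)
  rw [AlgHom.commutes, ord_belowM_algebraMap, ord_belowM_algebraMap, below_galSpec, hc, mul_one,
    mul_one] at e1
  unfold valM
  rw [key]
  rw [below_galSpec] at hN ⊢
  have e1' : ((below ho P).asIdeal.ramificationIdx' (belowM ho (galSpec σ P) N).asIdeal : ℚ) =
    (n : ℚ) *
      ((below ho P).asIdeal.ramificationIdx' (belowM ho P M).asIdeal : ℚ) := by exact_mod_cast e1
  have hMN : (n : ℚ) ≠ 0 := by
    intro h0
    rw [h0, zero_mul] at e1'
    exact hN (by exact_mod_cast e1')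
  have hM' : ((below ho P).asIdeal.ramificationIdx' (belowM ho P M).asIdeal : ℚ) ≠ 0 := by
    exact_mod_cast hM
  rw [e1']
  push_cast
  field_simp

theorem val_baseUnit_galSpec (ho : ¬ IsField o) (σ : Gal(L/K))
    (P : MaximalSpectrum (integralClosure o L)) (c : o⁰) :
    val K ho (galSpec σ P) (baseUnit K L c) = val K ho P (baseUnit K L c) :=
  val_galSpec ho σ P (by
    rw [coe_baseUnit, IsScalarTower.algebraMap_apply o K L, AlgEquiv.commutes])

theorem val_galSpec_eq (ho : ¬ IsField o) (σ : Gal(L/K))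
    (P : MaximalSpectrum (integralClosure o L)) (u : Lˣ) :
    val K ho (galSpec σ P) u = val K ho P (galUnit σ⁻¹ u) := by
  rw [← val_galSpec ho σ⁻¹ (galSpec σ P) (coe_galUnit σ⁻¹ u), galSpec_inv_galSpec]

theorem valMonoid_galSpec (ho : ¬ IsField o) (σ : Gal(L/K))
    (P : MaximalSpectrum (integralClosure o L)) :
    valMonoid K ho (galSpec σ P) = valMonoid K ho P := by
  ext a
  refine and_congr_left fun _ => ⟨?_, ?_⟩
  · rintro ⟨x, hx⟩
    refine ⟨galUnit σ⁻¹ x, ?_⟩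
    rw [hx, ← val_galSpec ho σ⁻¹ (galSpec σ P) (coe_galUnit _ x), galSpec_inv_galSpec]
  · rintro ⟨x, hx⟩
    refine ⟨galUnit σ x, ?_⟩
    rw [hx, ← val_galSpec ho σ P (coe_galUnit _ x)]

theorem valClosure_galSpec (ho : ¬ IsField o) (σ : Gal(L/K))
    (P : MaximalSpectrum (integralClosure o L)) :
    valClosure K ho (galSpec σ P) = valClosure K ho P := by
  have h : ∀ Q : MaximalSpectrum (integralClosure o L),
      (Set.range fun x : Lˣ => (val K ho Q x : ℝ)) =
        {r | (⟨r, false⟩ : RTilde) ∈ valMonoid K ho Q} := by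
    intro Q
    ext r
    exact ⟨fun ⟨x, hx⟩ => ⟨⟨x, hx.symm⟩, rfl⟩, fun ⟨⟨x, hx⟩, _⟩ => ⟨x, hx.symm⟩⟩
  rw [valClosure, valClosure, h, h, valMonoid_galSpec]

theorem VTilde_galSpec (ho : ¬ IsField o) (σ : Gal(L/K))
    (P : MaximalSpectrum (integralClosure o L)) :
    VTilde K ho (galSpec σ P) = VTilde K ho P := by
  ext a
  change a ∈ valMonoid K ho _ ∨ _ ↔ a ∈ valMonoid K ho _ ∨ _
  rw [valMonoid_galSpec, valClosure_galSpec]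

end Valuation

/-! ### Greatest lower bounds in `RTilde` -/

namespace RTilde

theorem le_iff (a b : RTilde) :
    a ≤ b ↔ a.re < b.re ∨ (a.re = b.re ∧ a.flag ≤ b.flag) :=
  Prod.Lex.toLex_le_toLex (x := (a.re, a.flag)) (y := (b.re, b.flag))

theorem re_le_re {a b : RTilde} (h : a ≤ b) : a.re ≤ b.re := by
  rcases (le_iff a b).1 h with h | h
  · exact h.le
  · exact h.1.le

theorem lt_mk_false_iff {a : RTilde} {r : ℝ} : a < ⟨r, false⟩ ↔ a.re < r := by
  simp [lt_iff]

theorem le_mk_true_iff {a : RTilde} {r : ℝ} : a ≤ ⟨r, true⟩ ↔ a.re ≤ r := by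
  simp only [le_iff, Bool.le_true, and_true, ← le_iff_lt_or_eq]

theorem mk_false_le_iff {a : RTilde} {r : ℝ} : ⟨r, false⟩ ≤ a ↔ r ≤ a.re := by
  rw [← not_lt, lt_mk_false_iff, not_lt]

/-- (r, 1) is the immediate successor of (r, 0). This turns a bound by an attained value into a
strict inequality, to which semicontinuity applies. -/
theorem lt_mk_true_iff {a : RTilde} {r : ℝ} : a < ⟨r, true⟩ ↔ a ≤ ⟨r, false⟩ := by
  cases h : a.flag <;> simp [lt_iff, le_iff, h]

theorem re_lt_of_flag {a s : RTilde} (h : a ≤ s) (ha : a.flag = true) (hs : s.flag = false) :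
    a.re < s.re := by
  rcases (le_iff a s).1 h with h | ⟨-, h⟩
  · exact h
  · rw [ha, hs] at h
    exact absurd h (by decide)

variable {S T U : Set RTilde} {a b : RTilde}

theorem exists_re_lt_of_isGLB (h : IsGLB S a) {ε : ℝ} (hε : 0 < ε) :
    ∃ s ∈ S, s.re < a.re + ε := by
  have h1 : a < ⟨a.re + ε, false⟩ := lt_mk_false_iff.2 (by linarith)
  obtain ⟨s, hs, hs'⟩ := (isGLB_lt_iff h).1 h1
  exact ⟨s, hs, lt_mk_false_iff.1 hs'⟩

/-- An infimum with flag 0 has an immediate successor, so some element of S lies below that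
successor and must equal the infimum. -/
theorem mem_of_isGLB (h : IsGLB S a) (hS : ∀ s ∈ S, s.flag = false) (ha : a.flag = false) :
    a ∈ S := by
  have h1 : a < ⟨a.re, true⟩ := (lt_iff _ _).2 (Or.inr ⟨rfl, by simp [ha]⟩)
  obtain ⟨s, hs, hs'⟩ := (isGLB_lt_iff h).1 h1
  have h2 := re_le_re (lt_mk_true_iff.1 hs')
  have h3 := re_le_re (h.1 hs)
  have : a = s := RTilde.ext (le_antisymm h3 h2) (by rw [ha, hS s hs])
  exact this ▸ hs

theorem isGLB_of_approx (h : a ∈ lowerBounds S) (h0 : a.flag = false → a ∈ S)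
    (h1 : a.flag = true → ∀ ε > 0, ∃ s ∈ S, s.re < a.re + ε) : IsGLB S a := by
  refine ⟨h, fun c hc => ?_⟩
  cases hf : a.flag
  · exact hc (h0 hf)
  · have ha : a = ⟨a.re, true⟩ := RTilde.ext rfl hf
    rw [ha, le_mk_true_iff]
    refine le_of_forall_pos_lt_add fun ε hε => ?_
    obtain ⟨s, hs, hs'⟩ := h1 hf ε hε
    exact (re_le_re (hc hs)).trans_lt hs'

/-- If the sum has flag 0, both infima are attained and so is their sum; otherwise approximate each
within ε/2. The set U may exceed the sums, as long as each of its elements dominates one. -/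
theorem isGLB_add (hS : IsGLB S a) (hT : IsGLB T b) (hS0 : ∀ s ∈ S, s.flag = false)
    (hT0 : ∀ t ∈ T, t.flag = false) (h1 : ∀ s ∈ S, ∀ t ∈ T, s + t ∈ U)
    (h2 : ∀ u ∈ U, ∃ s ∈ S, ∃ t ∈ T, s + t ≤ u) : IsGLB U (a + b) := by
  refine isGLB_of_approx ?_ ?_ ?_
  · intro u hu
    obtain ⟨s, hs, t, ht, hst⟩ := h2 u hu
    exact (add_le_add (hS.1 hs) (hT.1 ht)).trans hst
  · intro h
    replace h := max_eq_bot.1 h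
    exact h1 _ (mem_of_isGLB hS hS0 h.1) _ (mem_of_isGLB hT hT0 h.2)
  · intro _ ε hε
    obtain ⟨s, hs, hs'⟩ := exists_re_lt_of_isGLB hS (half_pos hε)
    obtain ⟨t, ht, ht'⟩ := exists_re_lt_of_isGLB hT (half_pos hε)
    refine ⟨s + t, h1 s hs t ht, ?_⟩
    rw [add_re, add_re]
    linarith

end RTilde

theorem exists_unit_mem {o L : Type*} [CommRing o] [Field L] [Algebra o L]
    (I : FracIdeals o L) :
    ∃ u : Lˣ, (u : L) ∈ (I : FractionalIdeal (integralClosure o L)⁰ L) := by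
  by_contra! hc
  refine I.2 (FractionalIdeal.eq_zero_iff.2 fun x hx => ?_)
  by_contra h0
  exact hc (Units.mk0 x h0) hx

/-! ### The function of a fractional ideal -/

section Valuation

variable {o K L : Type*} [CommRing o] [IsDedekindDomain o] [Field K] [Algebra o K]
  [IsFractionRing o K] [Field L] [Algebra K L] [Algebra o L] [IsScalarTower o K L]
  [Algebra.IsSeparable K L]

variable (K) in
/-- The value of `u` at `P`, as an element of `ℝ × {0, 1}`. -/
noncomputable def valT (ho : ¬ IsField o) (P : MaximalSpectrum (integralClosure o L)) (u : Lˣ) :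
    RTilde := ⟨val K ho P u, false⟩

variable (ho : ¬ IsField o) (P : MaximalSpectrum (integralClosure o L))

theorem valT_le_valT_iff {u v : Lˣ} : valT K ho P u ≤ valT K ho P v ↔
    val K ho P u ≤ val K ho P v := by
  rw [valT, RTilde.mk_false_le_iff]
  exact Rat.cast_le

theorem valT_mul (u v : Lˣ) : valT K ho P (u * v) = valT K ho P u + valT K ho P v :=
  RTilde.ext (by simp [valT, val_mul]) rfl

theorem valT_galSpec_eq (σ : Gal(L/K)) (u : Lˣ) :
    valT K ho (galSpec σ P) u = valT K ho P (galUnit σ⁻¹ u) := by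
  rw [valT, val_galSpec_eq, valT]

variable (K) in
/-- The values at `P` of a fractional ideal are bounded below in terms of an element of `o`. -/
theorem exists_neg_val_baseUnit_le (I : FracIdeals o L) :
    ∃ c : o⁰, ∀ (P : MaximalSpectrum (integralClosure o L)) (u : Lˣ),
      (u : L) ∈ (I : FractionalIdeal (integralClosure o L)⁰ L) →
        -val K ho P (baseUnit K L c) ≤ val K ho P u := by
  obtain ⟨d, hd, h⟩ := (I : FractionalIdeal (integralClosure o L)⁰ L).isFractional
  have hd0 : (d : L) ≠ 0 := fun h0 => nonZeroDivisors.ne_zero hd (Subtype.ext h0)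
  obtain ⟨c, hc⟩ := exists_abs_val_le K ho (Units.mk0 (d : L) hd0)
  refine ⟨c, fun P u hu => ?_⟩
  have h1 := val_nonneg_of_isIntegral K ho P (u := Units.mk0 (d : L) hd0 * u) (by
    obtain ⟨y, hy⟩ := h u hu
    have hy' : (y : L) = (d : L) * u := hy
    rw [Units.val_mul, Units.val_mk0, ← hy']
    exact y.2)
  rw [val_mul] at h1
  have h2 := (abs_le.1 (hc P)).2
  linarith

theorem isGLB_fTilde (I : FracIdeals o L) :
    IsGLB (valT K ho P '' {u | (u : L) ∈ (I : FractionalIdeal (integralClosure o L)⁰ L)})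
      (fTilde K ho I P) := by
  obtain ⟨c, hc⟩ := exists_neg_val_baseUnit_le K ho I
  obtain ⟨u₀, hu₀⟩ := exists_unit_mem I
  have hne : (valuesOn K ho I P).Nonempty := ⟨_, u₀, hu₀, rfl⟩
  have hbdd : BddBelow (valuesOn K ho I P) := by
    refine ⟨-(val K ho P (baseUnit K L c) : ℝ), ?_⟩
    rintro _ ⟨u, hu, rfl⟩
    exact_mod_cast hc P u hu
  refine RTilde.isGLB_of_approx ?_ ?_ ?_
  · rintro _ ⟨u, hu, rfl⟩
    have hle : sInf (valuesOn K ho I P) ≤ val K ho P u := csInf_le hbdd ⟨u, hu, rfl⟩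
    rw [RTilde.le_iff]
    rcases hle.lt_or_eq with h | h
    · exact Or.inl h
    · refine Or.inr ⟨h, ?_⟩
      have hmem : sInf (valuesOn K ho I P) ∈ valuesOn K ho I P := ⟨u, hu, h⟩
      simp [fTilde, hmem]
  · intro hf
    have hmem : sInf (valuesOn K ho I P) ∈ valuesOn K ho I P := by
      by_contra hn
      simp [fTilde, hn] at hf
    obtain ⟨u, hu, h⟩ := hmem
    exact ⟨u, hu, RTilde.ext h.symm hf.symm⟩
  · intro _ ε hε
    obtain ⟨_, ⟨u, hu, rfl⟩, h⟩ :=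
      exists_lt_of_csInf_lt hne (b := sInf (valuesOn K ho I P) + ε) (by linarith)
    exact ⟨_, ⟨u, hu, rfl⟩, h⟩

theorem fTilde_le_valT {I : FracIdeals o L} {u : Lˣ}
    (hu : (u : L) ∈ (I : FractionalIdeal (integralClosure o L)⁰ L)) :
    fTilde K ho I P ≤ valT K ho P u :=
  (isGLB_fTilde ho P I).1 ⟨u, hu, rfl⟩

theorem exists_mem_valT_lt {I : FracIdeals o L} {a : RTilde} (h : fTilde K ho I P < a) :
    ∃ u : Lˣ, (u : L) ∈ (I : FractionalIdeal (integralClosure o L)⁰ L) ∧ valT K ho P u < a := by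
  obtain ⟨_, ⟨u, hu, rfl⟩, h'⟩ := (isGLB_lt_iff (isGLB_fTilde ho P I)).1 h
  exact ⟨u, hu, h'⟩

/-- An element of IJ is a sum of products, and by the ultrametric inequality its value is at least
that of one of these products. Hence products alone determine the infimum. -/
theorem fTilde_mul (I J : FracIdeals o L) :
    fTilde K ho (I * J) P = fTilde K ho I P + fTilde K ho J P := by
  refine (isGLB_fTilde ho P (I * J)).unique (RTilde.isGLB_add (isGLB_fTilde ho P I)
    (isGLB_fTilde ho P J) ?_ ?_ ?_ ?_)
  · rintro _ ⟨u, -, rfl⟩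
    rfl
  · rintro _ ⟨u, -, rfl⟩
    rfl
  · rintro _ ⟨u, hu, rfl⟩ _ ⟨v, hv, rfl⟩
    exact ⟨u * v, FractionalIdeal.mul_mem_mul hu hv, valT_mul ho P u v⟩
  · rintro _ ⟨w, hw, rfl⟩
    have key : ∀ z ∈ ((I : FractionalIdeal (integralClosure o L)⁰ L) *
        (J : FractionalIdeal (integralClosure o L)⁰ L)), ∀ w : Lˣ, (w : L) = z →
        ∃ u v : Lˣ, (u : L) ∈ (I : FractionalIdeal (integralClosure o L)⁰ L) ∧
          (v : L) ∈ (J : FractionalIdeal (integralClosure o L)⁰ L) ∧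
          val K ho P u + val K ho P v ≤ val K ho P w := by
      intro z hz
      refine FractionalIdeal.mul_induction_on hz ?_ ?_
      · intro x hx y hy w hw
        have hxy : x * y ≠ 0 := hw ▸ w.ne_zero
        refine ⟨Units.mk0 x (left_ne_zero_of_mul hxy), Units.mk0 y (right_ne_zero_of_mul hxy),
          hx, hy, ?_⟩
        rw [← val_mul]
        exact le_of_eq (congrArg _ (Units.ext hw.symm))
      · intro x y hx hy w hw
        by_cases hx0 : x = 0
        · exact hy w (by rw [hw, hx0, zero_add])
        by_cases hy0 : y = 0
        · exact hx w (by rw [hw, hy0, add_zero])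
        rcases min_le_iff.1 (min_val_le_val_add K ho P (x := Units.mk0 x hx0)
          (y := Units.mk0 y hy0) hw) with h | h
        · obtain ⟨u, v, hu, hv, huv⟩ := hx (Units.mk0 x hx0) rfl
          exact ⟨u, v, hu, hv, huv.trans h⟩
        · obtain ⟨u, v, hu, hv, huv⟩ := hy (Units.mk0 y hy0) rfl
          exact ⟨u, v, hu, hv, huv.trans h⟩
    obtain ⟨u, v, hu, hv, huv⟩ := key w hw w rfl
    refine ⟨_, ⟨u, hu, rfl⟩, _, ⟨v, hv, rfl⟩, ?_⟩
    rwa [← valT_mul, valT_le_valT_iff, val_mul]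

/-- Membership in a fractional ideal can be tested on values. -/
theorem mem_iff_forall_fTilde_le {I : FracIdeals o L} {u : Lˣ} :
    (u : L) ∈ (I : FractionalIdeal (integralClosure o L)⁰ L) ↔
      ∀ P, fTilde K ho I P ≤ valT K ho P u := by
  refine ⟨fun hu P => fTilde_le_valT ho P hu, fun h => ?_⟩
  -- D consists of the s with su ∈ I, and 1 ∈ D is wanted. If D lay in a maximal ideal P, take y ∈ I
  -- with v_P(y) ≤ v_P(u): then u/y lies in the localization at P, so a denominator s outside P
  -- gives su = (s·u/y)·y ∈ I, a contradiction.
  let D : Ideal (integralClosure o L) :=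
    ((I : FractionalIdeal (integralClosure o L)⁰ L) : Submodule (integralClosure o L) L).comap
      (LinearMap.toSpanSingleton (integralClosure o L) L u)
  have hD : ∀ s : integralClosure o L,
      s ∈ D ↔ (s : L) * u ∈ (I : FractionalIdeal (integralClosure o L)⁰ L) := fun s => Iff.rfl
  suffices hT : D = ⊤ by
    have h1 := (hD 1).1 (by rw [hT]; trivial)
    rwa [OneMemClass.coe_one, one_mul] at h1
  by_contra hT
  obtain ⟨m, hm, hDm⟩ := Ideal.exists_le_maximal D hT
  let P : MaximalSpectrum (integralClosure o L) := ⟨m, hm⟩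
  obtain ⟨y, hy, hyu⟩ := exists_mem_valT_lt ho P
    ((h P).trans_lt (RTilde.lt_mk_true_iff.2 le_rfl))
  have hyu' := (valT_le_valT_iff ho P).1 (RTilde.lt_mk_true_iff.1 hyu)
  have hnonneg : 0 ≤ val K ho P (u * y⁻¹) := by
    rw [val_mul, val_inv]
    linarith
  obtain ⟨s, hs, hsint⟩ := exists_notMem_isIntegral_mul K ho P hnonneg
  refine hs (hDm ((hD s).2 ?_))
  have h2 := Submodule.smul_mem
    ((I : FractionalIdeal (integralClosure o L)⁰ L) : Submodule (integralClosure o L) L)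
    (⟨_, hsint⟩ : integralClosure o L) hy
  have h3 : (s : L) * ((u * y⁻¹ : Lˣ) : L) * (y : L) = (s : L) * u := by
    rw [Units.val_mul, mul_assoc, mul_assoc, Units.inv_mul, mul_one]
  rw [← h3]
  exact h2

theorem fTilde_injective {I J : FracIdeals o L} (h : ∀ P, fTilde K ho I P = fTilde K ho J P) :
    I = J := by
  refine Subtype.ext (FractionalIdeal.ext fun x => ?_)
  by_cases hx : x = 0
  · rw [hx]
    exact iff_of_true (FractionalIdeal.zero_mem _) (FractionalIdeal.zero_mem _)
  · have h1 := mem_iff_forall_fTilde_le (K := K) ho (I := I) (u := Units.mk0 x hx)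
    have h2 := mem_iff_forall_fTilde_le (K := K) ho (I := J) (u := Units.mk0 x hx)
    simp only [h] at h1
    exact h1.trans h2.symm

theorem fTilde_galIdeal (σ : Gal(L/K)) (I : FracIdeals o L) :
    fTilde K ho (galIdeal σ I) P = fTilde K ho I (galSpec σ⁻¹ P) := by
  refine (isGLB_fTilde ho P (galIdeal σ I)).unique ?_
  convert isGLB_fTilde ho (galSpec σ⁻¹ P) I using 1
  ext a
  constructor
  · rintro ⟨u, ⟨x, hx, hxu⟩, rfl⟩
    have hx' : x = galUnit σ⁻¹ u := by
      rw [coe_galUnit, ← hxu, ← AlgEquiv.mul_apply, inv_mul_cancel, AlgEquiv.one_apply]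
    have hmem : (galUnit σ⁻¹ u : L) ∈ (I : FractionalIdeal (integralClosure o L)⁰ L) := hx' ▸ hx
    refine ⟨galUnit σ⁻¹ u, hmem, ?_⟩
    rw [← valT_galSpec_eq, galSpec_galSpec_inv]
  · rintro ⟨u, hu, rfl⟩
    refine ⟨galUnit σ u, ⟨u, hu, rfl⟩, ?_⟩
    rw [valT_galSpec_eq, inv_inv]

/-- Nonattained infima exist only for dense value groups. -/
theorem fTilde_mem_VTilde (I : FracIdeals o L) : fTilde K ho I P ∈ VTilde K ho P := by
  have hglb := isGLB_fTilde (K := K) ho P I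
  have hS : ∀ s ∈ valT K ho P '' {u | (u : L) ∈ (I : FractionalIdeal (integralClosure o L)⁰ L)},
      s.flag = false := by
    rintro _ ⟨u, -, rfl⟩
    rfl
  cases hf : (fTilde K ho I P).flag
  · obtain ⟨u, -, hu⟩ := RTilde.mem_of_isGLB hglb hS hf
    exact Or.inl ⟨⟨u, (congrArg RTilde.re hu).symm⟩, hf⟩
  · refine Or.inr ⟨?_, hf⟩
    let V : AddSubgroup ℝ :=
      { carrier := Set.range fun x : Lˣ => (val K ho P x : ℝ)
        zero_mem' := ⟨1, by simp [val_one]⟩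
        add_mem' := by
          rintro _ _ ⟨x, rfl⟩ ⟨y, rfl⟩
          exact ⟨x * y, by simp [val_mul]⟩
        neg_mem' := by
          rintro _ ⟨x, rfl⟩
          exact ⟨x⁻¹, by simp [val_inv]⟩ }
    rcases V.dense_or_cyclic with hd | ⟨g, hg⟩
    · exact hd.closure_eq
    · exfalso
      have hV : ∀ x : Lˣ, ∃ n : ℤ, (val K ho P x : ℝ) = n * g := by
        intro x
        have hx : (val K ho P x : ℝ) ∈ V := ⟨x, rfl⟩
        rw [hg, AddSubgroup.mem_closure_singleton] at hx
        obtain ⟨n, hn⟩ := hx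
        exact ⟨n, by rw [← hn, zsmul_eq_mul]⟩
      -- The margin is |g| if g ≠ 0 and 1 if g = 0. As the infimum is not attained, there are two
      -- distinct values within this margin above it; their difference is a nonzero multiple of g
      -- smaller than |g|, or nonzero although g = 0, which is impossible.
      have hpos : 0 < |g| + 1 - (if g = 0 then 0 else 1) := by
        split_ifs with h0
        · simp [h0]
        · simpa using h0
      obtain ⟨_, ⟨u, hu, rfl⟩, h1⟩ := RTilde.exists_re_lt_of_isGLB hglb hpos
      have h2 := RTilde.re_lt_of_flag (fTilde_le_valT ho P hu) hf rfl
      obtain ⟨_, ⟨v, hv, rfl⟩, h3⟩ := RTilde.exists_re_lt_of_isGLB hglb (sub_pos.2 h2)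
      have h4 := RTilde.re_lt_of_flag (fTilde_le_valT ho P hv) hf rfl
      obtain ⟨m, hm⟩ := hV u
      obtain ⟨n, hn⟩ := hV v
      simp only [valT] at h1 h2 h3 h4
      rw [hm] at h1 h2 h3
      rw [hn] at h3 h4
      have h5 : 0 < ((m - n : ℤ) : ℝ) * g := by push_cast; linarith
      by_cases h0 : g = 0
      · simp [h0] at h5
      · rw [if_neg h0] at h1
        have h6 : ((m - n : ℤ) : ℝ) * g < |g| := by push_cast; linarith
        have h7 : |((m - n : ℤ) : ℝ)| * |g| < 1 * |g| := by
          rw [← abs_mul, abs_of_pos h5, one_mul]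
          exact h6
        have h8 : |((m - n : ℤ) : ℝ)| < 1 := lt_of_mul_lt_mul_right h7 (abs_nonneg g)
        rw [← Int.cast_abs] at h8
        have h9 : |m - n| < 1 := by exact_mod_cast h8
        rw [Int.abs_lt_one_iff] at h9
        rw [h9] at h5
        simp at h5

end Valuation

/-! ### Admissible functions and the ideals they cut out -/

section Admissible

variable {o K L : Type*} [CommRing o] [IsDedekindDomain o] [Field K] [Algebra o K]
  [IsFractionRing o K] [Field L] [Algebra K L] [Algebra o L] [IsScalarTower o K L]
  [Algebra.IsSeparable K L]

variable (K) in
/-- The conditions on a function on the maximal spectrum that characterize the functions of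
fractional ideals: semicontinuity is expressed by finite subextensions, boundedness and finiteness
of the support by an element of `o`. -/
structure IsAdmissible (ho : ¬ IsField o) (F : MaximalSpectrum (integralClosure o L) → RTilde) :
    Prop where
  mem : ∀ P, F P ∈ VTilde K ho P
  lt : ∀ P a, F P < a → ∃ M : IntermediateField K L, FiniteDimensional K M ∧
    ∀ σ ∈ M.fixingSubgroup, F (galSpec σ P) < a
  bdd : ∃ c : o⁰, ∀ P, valT K ho P (baseUnit K L c)⁻¹ ≤ F P ∧ F P ≤ valT K ho P (baseUnit K L c)

variable (ho : ¬ IsField o)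

theorem isAdmissible_fTilde (I : FracIdeals o L) : IsAdmissible K ho (fTilde K ho I) where
  mem P := fTilde_mem_VTilde ho P I
  lt P a h := by
    obtain ⟨u, hu, hua⟩ := exists_mem_valT_lt ho P h
    -- For σ fixing u, the value of u at σ(P) equals that at P, so u witnesses the bound at σ(P)
    -- too.
    refine ⟨IntermediateField.adjoin K {(u : L)}, inferInstance, fun σ hσ => ?_⟩
    refine (fTilde_le_valT ho _ hu).trans_lt ?_
    have hfix : galUnit σ⁻¹ u = u := Units.ext
      ((IntermediateField.mem_fixingSubgroup_iff _ σ⁻¹).1 (inv_mem hσ) u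
        (IntermediateField.mem_adjoin_simple_self K (u : L)))
    rwa [valT_galSpec_eq, hfix]
  bdd := by
    obtain ⟨u, hu⟩ := exists_unit_mem I
    obtain ⟨c, hc⟩ := exists_abs_val_le K ho u
    obtain ⟨d, hd⟩ := exists_neg_val_baseUnit_le K ho I
    refine ⟨c * d, fun P => ?_⟩
    have h1 := val_baseUnit_nonneg K ho P c
    have h2 := val_baseUnit_nonneg K ho P d
    constructor
    · refine (isGLB_fTilde ho P I).2 ?_
      rintro _ ⟨v, hv, rfl⟩
      have h3 := hd P v hv
      rw [valT_le_valT_iff, val_inv, val_baseUnit_mul]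
      linarith
    · refine (fTilde_le_valT ho P hu).trans ?_
      have h3 := (abs_le.1 (hc P)).2
      rw [valT_le_valT_iff, val_baseUnit_mul]
      linarith

/-- This is the membership criterion for the unit ideal, whose function is at most (0, 0) because it
contains 1. -/
theorem isIntegral_of_val_nonneg {u : Lˣ} (h : ∀ P, 0 ≤ val K ho P u) : IsIntegral o (u : L) := by
  have hu : (u : L) ∈ ((1 : FracIdeals o L) : FractionalIdeal (integralClosure o L)⁰ L) := by
    rw [mem_iff_forall_fTilde_le (K := K) ho]
    intro P
    have h1 : ((1 : Lˣ) : L) ∈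
        ((1 : FracIdeals o L) : FractionalIdeal (integralClosure o L)⁰ L) :=
      FractionalIdeal.one_mem_one _
    refine (fTilde_le_valT ho P h1).trans ?_
    rw [valT_le_valT_iff, val_one]
    exact h P
  obtain ⟨a, ha⟩ := (FractionalIdeal.mem_one_iff _).1 hu
  rw [← ha]
  exact a.2

/-- Large values away from a given prime of a finite subextension, and value zero there. -/
theorem exists_val_eq_zero_and_le (P₀ : MaximalSpectrum (integralClosure o L)) (b : o⁰)
    (M : IntermediateField K L) [FiniteDimensional K M] :
    ∃ u : Lˣ,
      (∀ P, P.asIdeal.comap (inclM o M) = P₀.asIdeal.comap (inclM o M) → val K ho P u = 0) ∧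
      ∀ P, P.asIdeal.comap (inclM o M) ≠ P₀.asIdeal.comap (inclM o M) →
        val K ho P (baseUnit K L b) ≤ val K ho P u := by
  have hb : algebraMap o (integralClosure o M) b ≠ 0 :=
    (map_ne_zero_iff _ (FaithfulSMul.algebraMap_injective o (integralClosure o M))).2
      (nonZeroDivisors.ne_zero b.2)
  obtain ⟨r, hr, h⟩ := exists_notMem_and_dvd_mul (belowM ho P₀ M) hb
  have hcoe : ∀ a : integralClosure o M, a ≠ 0 → ((inclM o M a : integralClosure o L) : L) ≠ 0 :=
    fun a ha h0 => ha (Subtype.ext (Subtype.ext h0))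
  have hr0 : r ≠ 0 := fun h0 => hr (h0 ▸ zero_mem _)
  refine ⟨Units.mk0 _ (hcoe r hr0), fun P hP => ?_, fun P hP => ?_⟩
  · refine val_eq_zero_of_notMem K ho P (inclM o M r) rfl fun hm => hr ?_
    exact (hP ▸ hm : r ∈ P₀.asIdeal.comap (inclM o M))
  · obtain ⟨t, ht, s, hs⟩ := h (belowM ho P M)
      fun h => hP (congrArg IsDedekindDomain.HeightOneSpectrum.asIdeal h)
    have ht0 : t ≠ 0 := fun h0 => ht (h0 ▸ zero_mem _)
    have hs0 : s ≠ 0 := by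
      rintro rfl
      exact mul_ne_zero ht0 hr0 (hs.trans (mul_zero _))
    have h1 : val K ho P (Units.mk0 _ (hcoe t ht0)) = 0 :=
      val_eq_zero_of_notMem K ho P (inclM o M t) rfl ht
    have h2 : 0 ≤ val K ho P (Units.mk0 _ (hcoe s hs0)) :=
      val_nonneg_of_isIntegral K ho P (inclM o M s).2
    have h3 : Units.mk0 _ (hcoe t ht0) * Units.mk0 _ (hcoe r hr0) =
        baseUnit K L b * Units.mk0 _ (hcoe s hs0) := by
      refine Units.ext ?_
      have h4 := congrArg (inclM o M) hs
      rw [map_mul, map_mul, AlgHom.commutes] at h4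
      exact congrArg Subtype.val h4
    have h5 := congrArg (val K ho P) h3
    rw [val_mul, val_mul] at h5
    linarith

variable {ho} {F : MaximalSpectrum (integralClosure o L) → RTilde}

namespace IsAdmissible

/-- The fractional ideal cut out by an admissible function. -/
noncomputable def ideal (hF : IsAdmissible K ho F) : FracIdeals o L :=
  ⟨⟨{ carrier := {x | ∀ u : Lˣ, (u : L) = x → ∀ P, F P ≤ valT K ho P u}
      zero_mem' := fun u hu => absurd hu u.ne_zero
      add_mem' := by
        intro x y hx hy u hu P
        by_cases hx0 : x = 0
        · exact hy u (by rw [hu, hx0, zero_add]) P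
        by_cases hy0 : y = 0
        · exact hx u (by rw [hu, hy0, add_zero]) P
        rcases min_le_iff.1 (min_val_le_val_add K ho P (x := Units.mk0 x hx0)
          (y := Units.mk0 y hy0) hu) with h | h
        · exact (hx _ rfl P).trans ((valT_le_valT_iff ho P).2 h)
        · exact (hy _ rfl P).trans ((valT_le_valT_iff ho P).2 h)
      smul_mem' := by
        intro a x hx u hu P
        have hax : (a : L) * x ≠ 0 := fun h0 => u.ne_zero (hu.trans h0)
        refine (hx (Units.mk0 x (right_ne_zero_of_mul hax)) rfl P).trans ?_
        have hu' : u = Units.mk0 (a : L) (left_ne_zero_of_mul hax) *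
            Units.mk0 x (right_ne_zero_of_mul hax) := Units.ext hu
        rw [valT_le_valT_iff, hu', val_mul]
        linarith [val_nonneg_of_isIntegral K ho P
          (u := Units.mk0 (a : L) (left_ne_zero_of_mul hax)) a.2] },
    by
      obtain ⟨c, hc⟩ := hF.bdd
      -- The lower bound for F makes c a common denominator; below, the upper bound puts c itself
      -- into the ideal, which is therefore nonzero.
      refine ⟨algebraMap o _ c, ?_, fun x hx => ?_⟩
      · rw [mem_nonZeroDivisors_iff_ne_zero]
        intro h0
        exact (baseUnit K L c).ne_zero (congrArg Subtype.val h0)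
      · by_cases hx0 : x = 0
        · exact ⟨0, by rw [hx0, smul_zero, map_zero]⟩
        · have hint : IsIntegral o ((baseUnit K L c * Units.mk0 x hx0 : Lˣ) : L) := by
            refine isIntegral_of_val_nonneg (K := K) ho fun P => ?_
            have h1 := (hc P).1.trans (hx (Units.mk0 x hx0) rfl P)
            rw [valT_le_valT_iff, val_inv] at h1
            rw [val_mul]
            linarith
          exact ⟨⟨_, hint⟩, rfl⟩⟩,
    by
      obtain ⟨c, hc⟩ := hF.bdd
      intro h0
      exact (baseUnit K L c).ne_zero (FractionalIdeal.eq_zero_iff.1 h0 (baseUnit K L c)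
        fun u hu P => by rw [Units.ext hu]; exact (hc P).2)⟩

theorem mem_ideal (hF : IsAdmissible K ho F) {u : Lˣ} :
    (u : L) ∈ (hF.ideal : FractionalIdeal (integralClosure o L)⁰ L) ↔
      ∀ P, F P ≤ valT K ho P u :=
  ⟨fun h => h u rfl, fun h _ hv => Units.ext hv ▸ h⟩

end IsAdmissible

end Admissible

/-! ### Recovering an admissible function from its ideal -/

section Galois

variable {o K L : Type*} [CommRing o] [IsDedekindDomain o] [Field K] [Algebra o K]
  [IsFractionRing o K] [Field L] [Algebra K L] [Algebra o L] [IsScalarTower o K L]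
  [IsGalois K L] {ho : ¬ IsField o} {F : MaximalSpectrum (integralClosure o L) → RTilde}

namespace IsAdmissible

/-- Approximation: admissible values at a prime extend to elements of the ideal. -/
theorem exists_mem_ideal (hF : IsAdmissible K ho F) {P₀ : MaximalSpectrum (integralClosure o L)}
    {z : Lˣ} (hz : F P₀ ≤ valT K ho P₀ z) :
    ∃ x : Lˣ, (x : L) ∈ (hF.ideal : FractionalIdeal (integralClosure o L)⁰ L) ∧
      valT K ho P₀ x = valT K ho P₀ z := by
  obtain ⟨c, hc⟩ := hF.bdd
  obtain ⟨d, hd⟩ := exists_abs_val_le K ho z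
  obtain ⟨M₀, _, hM₀⟩ := hF.lt P₀ _ (RTilde.lt_mk_true_iff.2 hz)
  let M := M₀ ⊔ IntermediateField.adjoin K {(z : L)}
  have hzM : (z : L) ∈ M :=
    (le_sup_right : _ ≤ M) (IntermediateField.mem_adjoin_simple_self K (z : L))
  -- Away from P₀ ∩ M, the factor d compensates a possibly negative value of z and c dominates F, so
  -- zu satisfies the bound.
  obtain ⟨u, hu, hu'⟩ := exists_val_eq_zero_and_le ho P₀ (d * c) M
  refine ⟨z * u, hF.mem_ideal.2 fun P => ?_, ?_⟩
  · by_cases hP : P.asIdeal.comap (inclM o M) = P₀.asIdeal.comap (inclM o M)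
    · have hPu := hu P hP
      -- Primes agreeing with P₀ on M are conjugate to it under Gal(L/M), which fixes z and
      -- preserves the bound for F, as M contains both z and M₀.
      obtain ⟨σ, hσ, rfl⟩ := exists_galSpec_eq_of_comap_inclM M hP.symm
      have h1 := hM₀ σ (IntermediateField.fixingSubgroup_le le_sup_left hσ)
      rw [RTilde.lt_mk_true_iff] at h1
      have hfix : galUnit σ⁻¹ z = z := Units.ext
        ((IntermediateField.mem_fixingSubgroup_iff _ σ⁻¹).1 (inv_mem hσ) z hzM)
      refine h1.trans ?_
      change valT K ho P₀ z ≤ _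
      rw [valT_mul, valT_galSpec_eq, hfix, valT, valT, hPu]
      exact le_of_eq (RTilde.ext (by simp) rfl)
    · refine (hc P).2.trans ?_
      have h1 := hu' P hP
      rw [val_baseUnit_mul] at h1
      have h2 := (abs_le.1 (hd P)).1
      rw [valT_le_valT_iff, val_mul]
      linarith
  · exact RTilde.ext (by simp [valT, val_mul, hu P₀ rfl]) rfl

/-- A value with flag 0 is v_P(z) for some z, and approximation realizes it inside the ideal. A
value with flag 1 occurs only for dense value groups, so it is approached by values of such z from
above. -/
theorem fTilde_ideal (hF : IsAdmissible K ho F) (P : MaximalSpectrum (integralClosure o L)) :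
    fTilde K ho hF.ideal P = F P := by
  refine (isGLB_fTilde ho P hF.ideal).unique (RTilde.isGLB_of_approx ?_ ?_ ?_)
  · rintro _ ⟨u, hu, rfl⟩
    exact hF.mem_ideal.1 hu P
  · intro hf
    obtain ⟨⟨z, hz⟩, -⟩ | ⟨-, h⟩ := hF.mem P
    · have hz' : F P = valT K ho P z := RTilde.ext hz hf
      obtain ⟨x, hx, hxz⟩ := hF.exists_mem_ideal hz'.le
      exact ⟨x, hx, hxz.trans hz'.symm⟩
    · rw [hf] at h
      exact absurd h (by decide)
  · intro hf ε hε
    obtain ⟨-, h⟩ | ⟨hV, -⟩ := hF.mem P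
    · rw [hf] at h
      exact absurd h (by decide)
    · have hd : Dense (Set.range fun x : Lˣ => (val K ho P x : ℝ)) :=
        dense_iff_closure_eq.2 hV
      obtain ⟨_, ⟨z, rfl⟩, h1, h2⟩ := hd.exists_between (show (F P).re < (F P).re + ε by linarith)
      obtain ⟨x, hx, hxz⟩ := hF.exists_mem_ideal ((RTilde.le_iff _ (valT K ho P z)).2 (Or.inl h1))
      refine ⟨_, ⟨x, hx, rfl⟩, ?_⟩
      rw [hxz]
      exact h2

end IsAdmissible

end Galois

/-! ### Finitely supported families, and pointwise identities for ι -/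

section Functions

variable {X : Type*} [TopologicalSpace X]

theorem S0b_mono {M N : AddSubmonoid RTilde} (h : M ≤ N) : S0b X M ≤ S0b X N :=
  fun _ hf => ⟨fun x => h (hf.1 x), hf.2⟩

theorem exists_directSum_eq {ι : Type*} {β : ι → Type*} [∀ i, AddCommMonoid (β i)]
    (f : ∀ i, β i) (hf : {i | f i ≠ 0}.Finite) : ∃ g : ⨁ i, β i, ∀ i, g i = f i := by
  classical
  refine ⟨DFinsupp.mk hf.toFinset fun i => f i, fun i => ?_⟩
  change DFinsupp.mk hf.toFinset (fun i => f i) i = f i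
  rw [DFinsupp.mk_apply]
  split_ifs with h
  · rfl
  · by_contra h0
    exact h (hf.mem_toFinset.2 (Ne.symm h0))

/-- The hypothesis forces b to have real part -a.re and a flag no larger than that of a. Writing
ι(a) as a sum shows that ι∘f stays in any monoid of functions containing the two summands. -/
theorem RTilde.iota_eq_of_eq_add_add {a b : RTilde} (h : a = a + b + a) :
    RTilde.iota a = a + b + b := by
  have h1 := congrArg RTilde.re h
  have h2 := congrArg RTilde.flag h
  rw [RTilde.add_re, RTilde.add_re] at h1
  rw [RTilde.add_flag, RTilde.add_flag] at h2
  refine RTilde.ext ?_ ?_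
  · change -a.re = a.re + b.re + b.re
    linarith
  · change a.flag = max (max a.flag b.flag) b.flag
    rw [max_assoc, max_self]
    exact le_antisymm (le_max_left _ _) ((le_max_left _ _).trans h2.ge)

theorem RTilde.add_iota_add (a : RTilde) : a + RTilde.iota a + a = a :=
  RTilde.ext (by simp [RTilde.iota]) (by simp [RTilde.iota])

theorem RTilde.eq_iota_of_add_eq_zero {a b : RTilde} (h : a + b = 0) :
    a.flag = false ∧ b = RTilde.iota a := by
  have h1 : a.re + b.re = 0 := congrArg RTilde.re h
  have h2 : max a.flag b.flag = false := congrArg RTilde.flag h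
  have h3 := max_eq_bot.1 h2
  refine ⟨h3.1, RTilde.ext ?_ (h3.2.trans h3.1.symm)⟩
  change b.re = -a.re
  linarith

theorem RTilde.add_iota {a : RTilde} (h : a.flag = false) : a + RTilde.iota a = 0 :=
  RTilde.ext (by simp [RTilde.iota]) (by simp [RTilde.iota, h])

end Functions

/-! ### From the maximal spectrum to the quotients G/D -/

section Orbit

variable {o K L : Type*} [CommRing o] [Field K] [Algebra o K] [Field L] [Algebra K L]
  [Algebra o L] [IsScalarTower o K L]

variable (K) in
/-- The function `σ D_P ↦ F (σ P)`. -/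
noncomputable def orbitFun (F : MaximalSpectrum (integralClosure o L) → RTilde)
    (P : MaximalSpectrum (integralClosure o L)) (x : Gal(L/K) ⧸ decomp K P) : RTilde :=
  F (galSpec x.out P)

theorem orbitFun_mk (F : MaximalSpectrum (integralClosure o L) → RTilde)
    (P : MaximalSpectrum (integralClosure o L)) (σ : Gal(L/K)) :
    orbitFun K F P (QuotientGroup.mk σ) = F (galSpec σ P) :=
  congrArg F ((galSpec_eq_galSpec_iff _ σ P).2 (QuotientGroup.out_eq' _))

theorem under_eq_of_liesOver {o L : Type*} [CommRing o] [Field L] [Algebra o L]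
    {p : MaximalSpectrum o} {P : MaximalSpectrum (integralClosure o L)}
    (h : P.asIdeal.LiesOver p.asIdeal) : under P = p :=
  MaximalSpectrum.ext h.over.symm

end Orbit

/-! ### The isomorphism with families of semicontinuous functions -/

section Galois

variable {o K L : Type*} [CommRing o] [IsDedekindDomain o] [Field K] [Algebra o K]
  [IsFractionRing o K] [Field L] [Algebra K L] [Algebra o L] [IsScalarTower o K L]
  [IsGalois K L] {ho : ¬ IsField o} {F : MaximalSpectrum (integralClosure o L) → RTilde}

theorem IsAdmissible.orbitFun_mem (hF : IsAdmissible K ho F)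
    (P : MaximalSpectrum (integralClosure o L)) :
    orbitFun K F P ∈ S0b (Gal(L/K) ⧸ decomp K P) (VTilde K ho P) := by
  obtain ⟨c, hc⟩ := hF.bdd
  -- G/D is compact as a quotient of a profinite group, so the support condition is automatic.
  refine ⟨fun x => ?_, fun a => ?_, ?_, Set.univ, isCompact_univ, fun x hx => absurd trivial hx⟩
  · rw [← VTilde_galSpec ho x.out P]
    exact hF.mem _
  · rw [← (QuotientGroup.isQuotientMap_mk (N := decomp K P)).isOpen_preimage,
      isOpen_iff_mem_nhds]
    intro σ hσ
    have hσ' : orbitFun K F P (QuotientGroup.mk σ) < a := hσ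
    rw [orbitFun_mk] at hσ'
    obtain ⟨M, _, hM⟩ := hF.lt _ a hσ'
    -- The τ with τσ⁻¹ in Gal(L/M) form an open neighbourhood of σ, and τ(P) = (τσ⁻¹)(σ(P)).
    have hopen : IsOpen ((fun τ => τ * σ⁻¹) ⁻¹' (M.fixingSubgroup : Set Gal(L/K))) :=
      M.fixingSubgroup_isOpen.preimage (continuous_mul_const σ⁻¹)
    refine Filter.mem_of_superset (hopen.mem_nhds (by simp)) fun τ hτ => ?_
    have h1 := hM _ hτ
    rw [← galSpec_mul, inv_mul_cancel_right] at h1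
    change orbitFun K F P (QuotientGroup.mk τ) < a
    rwa [orbitFun_mk]
  · refine ⟨valT K ho P (baseUnit K L c)⁻¹, valT K ho P (baseUnit K L c), fun x => ?_⟩
    have h := hc (galSpec x.out P)
    rw [valT, valT, val_inv, val_baseUnit_galSpec] at h
    rwa [valT, valT, val_inv]

/-- Above a p not containing the bounding element c, its value is 0, which squeezes F between (0, 0)
and (0, 0). Only finitely many p contain c. -/
theorem IsAdmissible.finite_setOf_orbitFun_ne_zero (hF : IsAdmissible K ho F)
    {pL : MaximalSpectrum o → MaximalSpectrum (integralClosure o L)}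
    (hpL : ∀ p, under (pL p) = p) : {p | orbitFun K F (pL p) ≠ 0}.Finite := by
  obtain ⟨c, hc⟩ := hF.bdd
  refine (finite_setOf_mem c).subset fun p hp => ?_
  by_contra hcp
  refine hp (funext fun x => ?_)
  have h := hc (galSpec x.out (pL p))
  have h0 : val K ho (galSpec x.out (pL p)) (baseUnit K L c) = 0 := by
    refine val_baseUnit_eq_zero K ho _ fun hm => hcp ?_
    change (c : o) ∈ p.asIdeal
    rw [← hpL p, ← under_galSpec x.out]
    exact hm
  rw [valT, valT, val_inv, h0] at h
  refine le_antisymm (h.2.trans (le_of_eq ?_)) (le_trans (le_of_eq ?_) h.1)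
  · exact RTilde.ext (by simp) rfl
  · exact RTilde.ext (by simp) rfl

/-- Families of functions on the orbits come from admissible functions. -/
theorem exists_isAdmissible (ho : ¬ IsField o)
    {pL : MaximalSpectrum o → MaximalSpectrum (integralClosure o L)}
    (hpL : ∀ p, under (pL p) = p)
    (g : ∀ p, S0b (Gal(L/K) ⧸ decomp K (pL p)) (VTilde K ho (pL p)))
    (hg : {p | g p ≠ 0}.Finite) :
    ∃ F, IsAdmissible K ho F ∧ ∀ p, orbitFun K F (pL p) = g p := by
  have hex : ∀ P, ∃ σ : Gal(L/K), P = galSpec σ (pL (under P)) :=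
    fun P => exists_galSpec_eq_of_under (hpL (under P))
  choose s hs using hex
  let F : MaximalSpectrum (integralClosure o L) → RTilde :=
    fun P => (g (under P) : Gal(L/K) ⧸ decomp K (pL (under P)) → RTilde) (QuotientGroup.mk (s P))
  have hF : ∀ p (σ : Gal(L/K)), F (galSpec σ (pL p)) =
      (g p : Gal(L/K) ⧸ decomp K (pL p) → RTilde) (QuotientGroup.mk σ) := by
    intro p σ
    -- The quotient depends on the prime below, so q is kept variable to allow substitution;
    -- independence of the chosen τ is the description of cosets of the decomposition group.
    have key : ∀ (q : MaximalSpectrum o) (τ : Gal(L/K)), q = p →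
        galSpec σ (pL p) = galSpec τ (pL q) →
        (g q : Gal(L/K) ⧸ decomp K (pL q) → RTilde) (QuotientGroup.mk τ) =
          (g p : Gal(L/K) ⧸ decomp K (pL p) → RTilde) (QuotientGroup.mk σ) := by
      rintro q τ rfl h
      rw [(galSpec_eq_galSpec_iff σ τ _).1 h]
    exact key _ _ (by rw [under_galSpec, hpL]) (hs _)
  refine ⟨F, ⟨fun P => ?_, fun P a hP => ?_, ?_⟩, fun p => funext fun x => ?_⟩
  · rw [hs P, hF, VTilde_galSpec]
    exact (g (under P)).2.1 _
  · rw [hs P, hF] at hP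
    have hopen := ((g (under P)).2.2.1 a).preimage
      ((QuotientGroup.continuous_mk (N := decomp K (pL (under P)))).comp
        (continuous_mul_const (s P)))
    obtain ⟨M, hM, hMa⟩ := (krullTopology_mem_nhds_one_iff K L _).1
      (hopen.mem_nhds (x := 1) (by simpa using hP))
    refine ⟨M, hM, fun σ hσ => ?_⟩
    rw [hs P, ← galSpec_mul, hF]
    exact hMa hσ
  -- The extra 1 makes the bound on real parts strict, so that F(P) ≤ (v_P(c), 0) holds even when
  -- F(P) has flag 1.
  · have hbound : ∀ p, ∃ N : ℕ, ∀ x,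
        |((g p : Gal(L/K) ⧸ decomp K (pL p) → RTilde) x).re| + 1 ≤ N := by
      intro p
      obtain ⟨a, b, hab⟩ := (g p).2.2.2.1
      obtain ⟨N, hN⟩ := exists_nat_ge (max |a.re| |b.re| + 1)
      refine ⟨N, fun x => le_trans ?_ hN⟩
      have h1 := abs_le_max_abs_abs (RTilde.re_le_re (hab x).1) (RTilde.re_le_re (hab x).2)
      linarith
    choose N hN using hbound
    obtain ⟨c, hc⟩ := exists_le_val_baseUnit (L := L) K ho hg.toFinset (hg.toFinset.sup N)
    refine ⟨c, fun P => ?_⟩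
    rw [valT, valT, val_inv]
    by_cases hP : under P ∈ hg.toFinset
    · have h1 : ((N (under P) : ℕ) : ℝ) ≤ val K ho P (baseUnit K L c) := by
        have h2 := Finset.le_sup (f := N) hP
        have h3 := hc P hP
        have h4 : ((N (under P) : ℕ) : ℚ) ≤ val K ho P (baseUnit K L c) :=
          le_trans (by exact_mod_cast h2) h3
        exact_mod_cast h4
      have h5 : |(F P).re| + 1 ≤ N (under P) := hN (under P) _
      have h6 := abs_le.1 (show |(F P).re| ≤ |(F P).re| from le_rfl)
      constructor
      · rw [RTilde.mk_false_le_iff]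
        push_cast
        linarith [h6.1]
      · refine (RTilde.lt_mk_false_iff.2 ?_).le
        linarith [h6.2]
    · have h0 : g (under P) = 0 := by simpa using hP
      have h1 : F P = 0 := by
        change (g (under P) : Gal(L/K) ⧸ decomp K (pL (under P)) → RTilde) _ = 0
        rw [h0]
        rfl
      have h2 : (0 : ℝ) ≤ val K ho P (baseUnit K L c) := by
        exact_mod_cast val_baseUnit_nonneg K ho P c
      rw [h1]
      constructor
      · rw [RTilde.mk_false_le_iff]
        push_cast
        simpa using h2
      · rcases h2.lt_or_eq with h | h
        · exact (RTilde.lt_mk_false_iff.2 h).le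
        · exact le_of_eq (RTilde.ext h rfl)
  · induction x using QuotientGroup.induction_on with
    | H σ => rw [orbitFun_mk, hF]

/-- The isomorphism between fractional ideals and families of semicontinuous functions. -/
theorem exists_addEquiv (ho : ¬ IsField o)
    {pL : MaximalSpectrum o → MaximalSpectrum (integralClosure o L)}
    (hpL : ∀ p, under (pL p) = p) :
    ∃ Φ : Additive (FracIdeals o L) ≃+
        ⨁ p : MaximalSpectrum o, S0b (Gal(L/K) ⧸ decomp K (pL p)) (VTilde K ho (pL p)),
      ∀ (I : FracIdeals o L) (p : MaximalSpectrum o),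
        (Φ (Additive.ofMul I) p : Gal(L/K) ⧸ decomp K (pL p) → RTilde) =
          orbitFun K (fTilde K ho I) (pL p) := by
  have hex : ∀ I : FracIdeals o L,
      ∃ g : ⨁ p : MaximalSpectrum o, S0b (Gal(L/K) ⧸ decomp K (pL p)) (VTilde K ho (pL p)),
        ∀ p, (g p : Gal(L/K) ⧸ decomp K (pL p) → RTilde) =
          orbitFun K (fTilde K ho I) (pL p) := by
    intro I
    have hF := isAdmissible_fTilde (K := K) ho I
    obtain ⟨g, hg⟩ := exists_directSum_eq
      (fun p => (⟨_, hF.orbitFun_mem (pL p)⟩ :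
        S0b (Gal(L/K) ⧸ decomp K (pL p)) (VTilde K ho (pL p))))
      ((hF.finite_setOf_orbitFun_ne_zero hpL).subset
        fun p hp h0 => hp (Subtype.ext h0))
    exact ⟨g, fun p => congrArg Subtype.val (hg p)⟩
  choose φ hφ using hex
  have hinj : Function.Injective φ := by
    intro I J hIJ
    refine fTilde_injective (K := K) ho fun P => ?_
    obtain ⟨σ, hσ⟩ := exists_galSpec_eq_of_under (K := K) (hpL (under P))
    rw [hσ, ← orbitFun_mk (fTilde K ho I), ← orbitFun_mk (fTilde K ho J), ← hφ, ← hφ, hIJ]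
  have hsurj : Function.Surjective φ := by
    intro g
    obtain ⟨F, hF, hFg⟩ := exists_isAdmissible ho hpL (fun p => g p) (DFinsupp.finite_support g)
    refine ⟨hF.ideal, DFinsupp.ext fun p => Subtype.ext ?_⟩
    rw [hφ, ← hFg p, show fTilde K ho hF.ideal = F from funext hF.fTilde_ideal]
  refine ⟨⟨Additive.toMul.trans (Equiv.ofBijective φ ⟨hinj, hsurj⟩), fun I J => ?_⟩,
    fun I p => hφ I p⟩
  refine DFinsupp.ext fun p => Subtype.ext ?_
  change (φ (I.toMul * J.toMul) p : Gal(L/K) ⧸ decomp K (pL p) → RTilde) =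
    (φ I.toMul p : Gal(L/K) ⧸ decomp K (pL p) → RTilde) + φ J.toMul p
  rw [hφ, hφ, hφ]
  exact funext fun x => fTilde_mul ho _ _ _

/-- Reflection of a family of reflexible functions. -/
theorem exists_iota_comp (ho : ¬ IsField o)
    {pL : MaximalSpectrum o → MaximalSpectrum (integralClosure o L)}
    (g : ⨁ p : MaximalSpectrum o, S0b (Gal(L/K) ⧸ decomp K (pL p)) (VTilde K ho (pL p)))
    (hg : ∀ p : MaximalSpectrum o, (g p : Gal(L/K) ⧸ decomp K (pL p) → RTilde) ∈
      Sref (Gal(L/K) ⧸ decomp K (pL p)) (VTilde K ho (pL p))) :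
    ∃ g' : ⨁ p : MaximalSpectrum o, S0b (Gal(L/K) ⧸ decomp K (pL p)) (VTilde K ho (pL p)),
      ∀ p, (g' p : Gal(L/K) ⧸ decomp K (pL p) → RTilde) = RTilde.iota ∘ g p := by
  obtain ⟨g', hg'⟩ := exists_directSum_eq
    (fun p => (⟨_, (hg p).2⟩ : S0b (Gal(L/K) ⧸ decomp K (pL p)) (VTilde K ho (pL p))))
    ((DFinsupp.finite_support g).subset fun p hp h0 => hp (Subtype.ext (by
      change RTilde.iota ∘ (g p : Gal(L/K) ⧸ decomp K (pL p) → RTilde) = 0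
      have h1 : g p = 0 := h0
      rw [h1]
      exact funext fun _ => RTilde.iota_zero)))
  exact ⟨g', fun p => congrArg Subtype.val (hg' p)⟩

end Galois

end KrullIdeals

open KrullIdeals in
theorem corollary2p10 {o K L : Type*} [CommRing o] [IsDedekindDomain o] (ho : ¬ IsField o)
    [Field K] [Algebra o K] [IsFractionRing o K] [Field L] [Algebra K L] [Algebra o L]
    [IsScalarTower o K L] [IsGalois K L]
    (pL : MaximalSpectrum o → MaximalSpectrum (integralClosure o L))
    (hpL : ∀ p : MaximalSpectrum o, (pL p).asIdeal.LiesOver p.asIdeal) :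
    ∃ Φ : Additive (FracIdeals o L) ≃+
        ⨁ p : MaximalSpectrum o, S0b (Gal(L/K) ⧸ decomp K (pL p)) (VTilde K ho (pL p)),
      -- `Φ` is induced by `I ↦ fTilde I` through `σ D_p ↦ σ(p_L)`
      (∀ (I : FracIdeals o L) (p : MaximalSpectrum o) (σ : Gal(L/K)),
        (Φ (Additive.ofMul I) p : Gal(L/K) ⧸ decomp K (pL p) → RTilde) (QuotientGroup.mk σ) =
          fTilde K ho I (galSpec σ (pL p))) ∧
      -- `Φ` is equivariant
      (∀ (σ : Gal(L/K)) (I : FracIdeals o L),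
        Φ (Additive.ofMul (galIdeal σ I)) =
          DirectSum.map (fun p => galFun (decomp K (pL p)) (VTilde K ho (pL p)) σ)
            (Φ (Additive.ofMul I))) ∧
      -- the image of the von Neumann regular elements
      (fun I : FracIdeals o L => Φ (Additive.ofMul I)) '' {I | ∃ J, I = I * J * I} =
        {g | ∀ p : MaximalSpectrum o, (g p : Gal(L/K) ⧸ decomp K (pL p) → RTilde) ∈
          Sref (Gal(L/K) ⧸ decomp K (pL p)) (VTilde K ho (pL p))} ∧
      -- the image of the invertible ideals
      (fun I : FracIdeals o L => Φ (Additive.ofMul I)) '' {I | ∃ J, I * J = 1} =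
        {g | ∀ p : MaximalSpectrum o, (g p : Gal(L/K) ⧸ decomp K (pL p) → RTilde) ∈
          Sref (Gal(L/K) ⧸ decomp K (pL p)) (valMonoid K ho (pL p))} := by
  have hpL' : ∀ p, under (pL p) = p := fun p => under_eq_of_liesOver (hpL p)
  obtain ⟨Φ, hΦ⟩ := exists_addEquiv (K := K) ho hpL'
  have hext : ∀ {g h : ⨁ p : MaximalSpectrum o,
      S0b (Gal(L/K) ⧸ decomp K (pL p)) (VTilde K ho (pL p))},
      (∀ p x, (g p : Gal(L/K) ⧸ decomp K (pL p) → RTilde) x =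
        (h p : Gal(L/K) ⧸ decomp K (pL p) → RTilde) x) → g = h :=
    fun hgh => DFinsupp.ext fun p => Subtype.ext (funext (hgh p))
  have hmul : ∀ (I J : FracIdeals o L) p,
      Φ (Additive.ofMul (I * J)) p = Φ (Additive.ofMul I) p + Φ (Additive.ofMul J) p := by
    intro I J p
    rw [ofMul_mul, map_add, DirectSum.add_apply]
  have hmono : ∀ P : MaximalSpectrum (integralClosure o L),
      valMonoid K ho P ≤ VTilde K ho P := fun P a ha => Or.inl ha
  refine ⟨Φ, fun I p σ => ?_, fun σ I => ?_, ?_, ?_⟩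
  · rw [hΦ, orbitFun_mk]
  · refine hext fun p x => ?_
    rw [DirectSum.map_apply]
    change _ = (Φ (Additive.ofMul I) p : Gal(L/K) ⧸ decomp K (pL p) → RTilde) (σ⁻¹ • x)
    rw [hΦ, hΦ]
    induction x using QuotientGroup.induction_on with
    | H τ =>
      change _ = orbitFun K _ _ (QuotientGroup.mk (σ⁻¹ * τ))
      rw [orbitFun_mk, orbitFun_mk, fTilde_galIdeal, galSpec_mul]
  · ext g
    constructor
    · rintro ⟨I, ⟨J, hJ⟩, rfl⟩ p
      refine ⟨(Φ (Additive.ofMul I) p).2, ?_⟩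
      have h1 : Φ (Additive.ofMul I) p = Φ (Additive.ofMul I) p + Φ (Additive.ofMul J) p +
          Φ (Additive.ofMul I) p := by
        rw [← hmul, ← hmul, ← hJ]
      -- From f = f + h + f, where f and h are the images of I and J, one gets ι∘f = f + h + h,
      -- hence it is again admissible.
      have h2 : RTilde.iota ∘ (Φ (Additive.ofMul I) p : Gal(L/K) ⧸ decomp K (pL p) → RTilde) =
          (Φ (Additive.ofMul I) p + Φ (Additive.ofMul J) p + Φ (Additive.ofMul J) p :
            S0b (Gal(L/K) ⧸ decomp K (pL p)) (VTilde K ho (pL p))) :=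
        funext fun x => RTilde.iota_eq_of_eq_add_add (congrFun (congrArg Subtype.val h1) x)
      change RTilde.iota ∘ (Φ (Additive.ofMul I) p : Gal(L/K) ⧸ decomp K (pL p) → RTilde) ∈ _
      rw [h2]
      exact SetLike.coe_mem _
    · intro hg
      obtain ⟨g', hg'⟩ := exists_iota_comp ho g hg
      -- The preimage of ι∘g serves as the quasi-inverse.
      refine ⟨(Φ.symm g).toMul, ⟨(Φ.symm g').toMul, ?_⟩, Φ.apply_symm_apply g⟩
      refine Additive.ofMul.injective (Φ.injective ?_)
      rw [ofMul_mul, ofMul_mul, map_add, map_add, ofMul_toMul, ofMul_toMul, Φ.apply_symm_apply,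
        Φ.apply_symm_apply]
      refine hext fun p x => ?_
      rw [DirectSum.add_apply, DirectSum.add_apply]
      have h1 := congrFun (hg' p) x
      change _ = _ + (g' p : Gal(L/K) ⧸ decomp K (pL p) → RTilde) x + _
      rw [h1]
      exact (RTilde.add_iota_add _).symm
  · ext g
    constructor
    · rintro ⟨I, ⟨J, hJ⟩, rfl⟩ p
      have h1 : Φ (Additive.ofMul I) p + Φ (Additive.ofMul J) p = 0 := by
        rw [← hmul, hJ, ofMul_one, map_zero, DirectSum.zero_apply]
      -- A sum with flag 0 has summands with flag 0, so the functions of I and J take values in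
      -- `valMonoid` and are exchanged by ι.
      have h2 := fun x => RTilde.eq_iota_of_add_eq_zero (congrFun (congrArg Subtype.val h1) x)
      have h3 := fun x => RTilde.eq_iota_of_add_eq_zero
        (congrFun (congrArg Subtype.val ((add_comm _ _).trans h1)) x)
      have hval : ∀ {a : RTilde}, a ∈ VTilde K ho (pL p) → a.flag = false →
          a ∈ valMonoid K ho (pL p) := by
        rintro a (ha | ⟨-, ha⟩) hf
        · exact ha
        · rw [hf] at ha
          exact absurd ha (by decide)
      have h4 : RTilde.iota ∘ (Φ (Additive.ofMul I) p : Gal(L/K) ⧸ decomp K (pL p) → RTilde) =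
          Φ (Additive.ofMul J) p := funext fun x => (h2 x).2.symm
      refine ⟨⟨fun x => hval ((Φ (Additive.ofMul I) p).2.1 x) (h2 x).1,
        (Φ (Additive.ofMul I) p).2.2⟩, ?_⟩
      change RTilde.iota ∘ (Φ (Additive.ofMul I) p : Gal(L/K) ⧸ decomp K (pL p) → RTilde) ∈ _
      rw [h4]
      exact ⟨fun x => hval ((Φ (Additive.ofMul J) p).2.1 x) (h3 x).1,
        (Φ (Additive.ofMul J) p).2.2⟩
    · intro hg
      obtain ⟨g', hg'⟩ := exists_iota_comp ho g fun p =>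
        ⟨(g p).2, S0b_mono (hmono (pL p)) (hg p).2⟩
      refine ⟨(Φ.symm g).toMul, ⟨(Φ.symm g').toMul, ?_⟩, Φ.apply_symm_apply g⟩
      refine Additive.ofMul.injective (Φ.injective ?_)
      rw [ofMul_mul, map_add, ofMul_toMul, ofMul_toMul, Φ.apply_symm_apply, Φ.apply_symm_apply,
        ofMul_one, map_zero]
      refine hext fun p x => ?_
      rw [DirectSum.add_apply]
      change _ + (g' p : Gal(L/K) ⧸ decomp K (pL p) → RTilde) x = _
      rw [congrFun (hg' p) x]
      exact RTilde.add_iota ((hg p).1.1 x).2
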